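/- **Setting.** Let $\Omega=(0,L_x)\times(0,L_y)\times(0,L_z)$ with $L_x,L_y,L_z>0$, and let $\varepsilon>0$. Consider all grids with $h=L_x/N_x=L_y/N_y=L_z/N_z$, where $N_x,N_y,N_z$ are positive integers, all $\gamma>0$, and all time steps $s=T/M$ with $T>0$ and $M$ a positive integer. Cell-centered functions $\phi=(\phi_{i,j,k})$ are given at the cells ($1\le i\le N_x$, etc.), located at $((i-\frac12)h,(j-\frac12)h,(k-\frac12)h)$, and at the ghost points adjacent to the boundary. The condition $n\cdot\nabla_h\phi=0$ means that every ghost value equals the value at the neighbouring cell. Let $\nabla_h$ be the centered difference gradient from cells to faces, $A_h$ the two-point average from cells to faces, $\nabla_h\cdot$ the centered difference divergence from faces to cells, and $\Delta_h=\nabla_h\cdot\nabla_h$, where $\Delta_h\phi$ is extended to the ghost points by $n\cdot\nabla_h\Delta_h\phi=0$. Put $\|\phi\|_p^p=h^3\sum_{i,j,k}|\phi_{i,j,k}|^p$ (sum over the cells), and let $\|\nabla_h\phi\|_2^2$ be the sum, over the three coordinate directions, of $\frac12h^3\sum_{i,j,k}$ of the squares of the corresponding component of $\nabla_h\phi$ at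 the two faces of the cell $(i,j,k)$ orthogonal to that direction. **Scheme.** $\phi^0,\dots,\phi^M$ are cell-centered functions with $n\cdot\nabla_h\phi^0=n\cdot\nabla_h\phi^1=0$, and for each $1\le m\le M-1$ there are cell-centered functions $\mu^{m+1/2},p^{m+1/2}$ with $n\cdot\nabla_h\phi^{m+1}=n\cdot\nabla_h\mu^{m+1/2}=n\cdot\nabla_hp^{m+1/2}=0$ such that at all cells $$\phi^{m+1}-\phi^m=s\nabla_h\cdot\big((1+\gamma (A_h\phi_*^{m+1/2})^2)\nabla_h\mu^{m+1/2}\big)+s\nabla_h\cdot\big(A_h\phi_*^{m+1/2}\,\nabla_hp^{m+1/2}\big),$$ $$\mu^{m+1/2}=\tfrac14\big((\phi^{m+1})^2+(\phi^m)^2\big)(\phi^{m+1}+\phi^m)-\phi_*^{m+1/2}-\varepsilon^2\Delta_h\big(\tfrac34\phi^{m+1}+\tfrac14\phi^{m-1}\big),$$ $$\Delta_hp^{m+1/2}=-\gamma\nabla_h\cdot\big(A_h\phi_*^{m+1/2}\,\nabla_h\mu^{m+1/2}\big),\qquad \phi_*^{m+1/2}=\tfrac32\phi^m-\tfrac12\phi^{m-1}.$$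 Let $E_h(\phi)=\frac14\|\phi\|_4^4-\frac12\|\phi\|_2^2+\frac{\varepsilon^2}2\|\nabla_h\phi\|_2^2$ and $F_h(\phi,\psi)=E_h(\phi)+\frac14\|\phi-\psi\|_2^2+\frac{\varepsilon^2}8\|\nabla_h(\phi-\psi)\|_2^2$. **Theorem** (uniform $\ell^2(0,T;H_h^3)$ stability). (i) For every $C_0$ there is a constant $C_{10}$, depending only on $L_x,L_y,L_z,\varepsilon,C_0$, and for every $K$ there is a constant $C_{11}$, depending only on $L_x,L_y,L_z,\varepsilon,C_0,K$, such that every solution of the scheme with $F_h(\phi^1,\phi^0)\le C_0$ and $s\|\nabla_h\Delta_h\phi^0\|_2^2\le K$, $s\|\nabla_h\Delta_h\phi^1\|_2^2\le K$ satisfies $$\frac1{16}\,\varepsilon^4 s\sum_{m=1}^{\ell}\|\nabla_h\Delta_h\phi^m\|_2^2\le C_{11}+C_{10}T\qquad\text{for all }1\le\ell\le M-1 .$$ (ii) For every $R$ there are constants $C_{10},C_{11}$, depending only on $L_x,L_y,L_z,\varepsilon,R$, such that the same bound holds for every solution of the scheme whose starting values $\phi^0,\phi^1$ are, at the cells, the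 point values of functions $\Phi_0,\Phi_1\in C^3(\overline\Omega)$ with $\partial_n\Phi_0=\partial_n\Phi_1=0$ on $\partial\Omega$ and with all derivatives of order at most $3$ bounded by $R$ on $\overline\Omega$ (derivatives as multilinear maps, in operator norm). In both parts the constants are independent of $h$, $s$, $M$, $T$, $\ell$ and $\gamma$. -/

import Mathlib

namespace CHHS

/-- A uniform cuboid grid: the numbers of cells in the three directions and the spatial step. -/
structure Grid where
  Nx : ℕ
  Ny : ℕ
  Nz : ℕ
  h : ℝ

/-- The grid discretizes `(0, Lx) × (0, Ly) × (0, Lz)`, that is, there is at least one cell in each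
direction and `h = Lx / Nx = Ly / Ny = Lz / Nz`. -/
structure Grid.Discretizes (G : Grid) (Lx Ly Lz : ℝ) : Prop where
  Nx_pos : 0 < G.Nx
  Ny_pos : 0 < G.Ny
  Nz_pos : 0 < G.Nz
  h_eq_x : G.h = Lx / G.Nx
  h_eq_y : G.h = Ly / G.Ny
  h_eq_z : G.h = Lz / G.Nz

/-- Cell-centered grid functions: `φ i j k` is the value at
`((i - 1/2) h, (j - 1/2) h, (k - 1/2) h)`. The cells are `1 ≤ i ≤ Nx`, `1 ≤ j ≤ Ny`,
`1 ≤ k ≤ Nz`; an index equal to `0` or to `Nx + 1` (`Ny + 1`, `Nz + 1`) is a ghost point. Values at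
other indices are never read. -/
abbrev CellFn : Type := ℤ → ℤ → ℤ → ℝ

/-- Face-centered (staggered) vector fields: `x i j k` is the value of the first component at the
face `(i + 1/2, j, k)`, `y i j k` that of the second one at `(i, j + 1/2, k)`, and `z i j k` that of
the third one at `(i, j, k + 1/2)`. -/
structure FaceField where
  x : ℤ → ℤ → ℤ → ℝ
  y : ℤ → ℤ → ℤ → ℝ
  z : ℤ → ℤ → ℤ → ℝ

/-- Componentwise product of face-centered fields. -/
def FaceField.mul (f g : FaceField) : FaceField where
  x := fun i j k => f.x i j k * g.x i j k
  y := fun i j k => f.y i j k * g.y i j k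
  z := fun i j k => f.z i j k * g.z i j k

/-- The face-centered field obtained by applying a scalar function to every component. -/
def FaceField.comp (F : ℝ → ℝ) (f : FaceField) : FaceField where
  x := fun i j k => F (f.x i j k)
  y := fun i j k => F (f.y i j k)
  z := fun i j k => F (f.z i j k)

/-- The index `(i, j, k)` is that of a cell (not of a ghost point). -/
def IsCell (G : Grid) (i j k : ℤ) : Prop :=
  (1 ≤ i ∧ i ≤ G.Nx) ∧ (1 ≤ j ∧ j ≤ G.Ny) ∧ (1 ≤ k ∧ k ≤ G.Nz)

/-- Discrete homogeneous Neumann boundary conditions, `n · ∇_h φ = 0`. -/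
structure Neumann (G : Grid) (φ : CellFn) : Prop where
  x_bdry : ∀ j k : ℤ, 1 ≤ j → j ≤ G.Ny → 1 ≤ k → k ≤ G.Nz →
    φ 0 j k = φ 1 j k ∧ φ G.Nx j k = φ (G.Nx + 1) j k
  y_bdry : ∀ i k : ℤ, 1 ≤ i → i ≤ G.Nx → 1 ≤ k → k ≤ G.Nz →
    φ i 0 k = φ i 1 k ∧ φ i G.Ny k = φ i (G.Ny + 1) k
  z_bdry : ∀ i j : ℤ, 1 ≤ i → i ≤ G.Nx → 1 ≤ j → j ≤ G.Ny →
    φ i j 0 = φ i j 1 ∧ φ i j G.Nz = φ i j (G.Nz + 1)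

/-- The discrete gradient `∇_h φ = (D_x φ, D_y φ, D_z φ)`. -/
noncomputable def grad (G : Grid) (φ : CellFn) : FaceField where
  x := fun i j k => (φ (i + 1) j k - φ i j k) / G.h
  y := fun i j k => (φ i (j + 1) k - φ i j k) / G.h
  z := fun i j k => (φ i j (k + 1) - φ i j k) / G.h

/-- The average `A_h φ = (A_x φ, A_y φ, A_z φ)` from cells to faces. -/
noncomputable def avg (φ : CellFn) : FaceField where
  x := fun i j k => (φ i j k + φ (i + 1) j k) / 2
  y := fun i j k => (φ i j k + φ i (j + 1) k) / 2
  z := fun i j k => (φ i j k + φ i j (k + 1)) / 2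

/-- The discrete divergence `∇_h · f = d_x f^x + d_y f^y + d_z f^z`, meaningful at the cells. -/
noncomputable def div (G : Grid) (f : FaceField) : CellFn := fun i j k =>
  (f.x i j k - f.x (i - 1) j k) / G.h + (f.y i j k - f.y i (j - 1) k) / G.h
    + (f.z i j k - f.z i j (k - 1)) / G.h

/-- The cell function with the same values as `ψ` at the cells, and with the ghost values that the
homogeneous Neumann boundary conditions prescribe. -/
def neumannExt (G : Grid) (ψ : CellFn) : CellFn := fun i j k =>
  ψ (max 1 (min i G.Nx)) (max 1 (min j G.Ny)) (max 1 (min k G.Nz))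

/-- The discrete Laplacian `Δ_h φ`: it is `∇_h · ∇_h φ` at the cells. Its ghost values, which enter
`∇_h Δ_h φ` only, are those of the homogeneous Neumann boundary conditions. -/
noncomputable def lap (G : Grid) (φ : CellFn) : CellFn := neumannExt G (div G (grad G φ))

/-- The inner product `(φ, ψ) = h³ ∑ φ_{ijk} ψ_{ijk}` of cell-centered functions. -/
noncomputable def cellInner (G : Grid) (φ ψ : CellFn) : ℝ :=
  G.h ^ 3 * ∑ i ∈ Finset.Icc (1 : ℤ) G.Nx, ∑ j ∈ Finset.Icc (1 : ℤ) G.Ny,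
    ∑ k ∈ Finset.Icc (1 : ℤ) G.Nz, φ i j k * ψ i j k

/-- `‖φ‖_p^p = (|φ|^p, 1)`. -/
noncomputable def normPow (G : Grid) (p : ℕ) (φ : CellFn) : ℝ :=
  cellInner G (fun i j k => |φ i j k| ^ p) (fun _ _ _ => 1)

/-- The inner product `[f^x, g^x]_x + [f^y, g^y]_y + [f^z, g^z]_z` of face-centered fields. -/
noncomputable def faceInner (G : Grid) (f g : FaceField) : ℝ :=
  (1 / 2) * G.h ^ 3 * (∑ i ∈ Finset.Icc (1 : ℤ) G.Nx, ∑ j ∈ Finset.Icc (1 : ℤ) G.Ny,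
      ∑ k ∈ Finset.Icc (1 : ℤ) G.Nz,
        (f.x i j k * g.x i j k + f.x (i - 1) j k * g.x (i - 1) j k))
  + (1 / 2) * G.h ^ 3 * (∑ i ∈ Finset.Icc (1 : ℤ) G.Nx, ∑ j ∈ Finset.Icc (1 : ℤ) G.Ny,
      ∑ k ∈ Finset.Icc (1 : ℤ) G.Nz,
        (f.y i j k * g.y i j k + f.y i (j - 1) k * g.y i (j - 1) k))
  + (1 / 2) * G.h ^ 3 * (∑ i ∈ Finset.Icc (1 : ℤ) G.Nx, ∑ j ∈ Finset.Icc (1 : ℤ) G.Ny,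
      ∑ k ∈ Finset.Icc (1 : ℤ) G.Nz,
        (f.z i j k * g.z i j k + f.z i j (k - 1) * g.z i j (k - 1)))

/-- `‖∇_h φ‖_2^2`. -/
noncomputable def gradNormSq (G : Grid) (φ : CellFn) : ℝ := faceInner G (grad G φ) (grad G φ)

/-- The discrete energy `E_h(φ) = ‖φ‖_4^4 / 4 - ‖φ‖_2^2 / 2 + ε² ‖∇_h φ‖_2^2 / 2`. -/
noncomputable def energy (G : Grid) (ε : ℝ) (φ : CellFn) : ℝ :=
  (1 / 4) * normPow G 4 φ - (1 / 2) * normPow G 2 φ + ε ^ 2 / 2 * gradNormSq G φ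

/-- The modified energy
`F_h(φ, ψ) = E_h(φ) + ‖φ - ψ‖_2^2 / 4 + ε² ‖∇_h (φ - ψ)‖_2^2 / 8`. -/
noncomputable def modEnergy (G : Grid) (ε : ℝ) (φ ψ : CellFn) : ℝ :=
  energy G ε φ + (1 / 4) * normPow G 2 (φ - ψ) + (1 / 8) * ε ^ 2 * gradNormSq G (φ - ψ)

/-- `φ_*^{m+1/2} = (3/2) φ^m - (1/2) φ^{m-1}`. -/
noncomputable def extrap (φprev φcur : CellFn) : CellFn := fun i j k =>
  (3 / 2) * φcur i j k - (1 / 2) * φprev i j k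

/-- `χ(φ, ψ) = (φ² + ψ²) (φ + ψ) / 4`. -/
noncomputable def chi (φ ψ : CellFn) : CellFn := fun i j k =>
  (1 / 4) * ((φ i j k) ^ 2 + (ψ i j k) ^ 2) * (φ i j k + ψ i j k)

/-- One step of the scheme, from `φprev = φ^{m-1}` and `φcur = φ^m` to `φnext = φ^{m+1}`, with
chemical potential `μ = μ^{m+1/2}` and pressure `p = p^{m+1/2}`. The mobility is
`M(v) = 1 + γ v²`. -/
structure IsStep (G : Grid) (ε γ s : ℝ) (φprev φcur φnext μ p : CellFn) : Prop where
  neumann_phi : Neumann G φnext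
  neumann_mu : Neumann G μ
  neumann_p : Neumann G p
  eq_phi : ∀ i j k, IsCell G i j k →
    φnext i j k - φcur i j k =
      s * div G (((avg (extrap φprev φcur)).comp (fun v => 1 + γ * v ^ 2)).mul (grad G μ)) i j k
      + s * div G ((avg (extrap φprev φcur)).mul (grad G p)) i j k
  eq_mu : ∀ i j k, IsCell G i j k →
    μ i j k = chi φnext φcur i j k - extrap φprev φcur i j k
      - ε ^ 2 * lap G (fun a b c => (3 / 4) * φnext a b c + (1 / 4) * φprev a b c) i j k
  eq_p : ∀ i j k, IsCell G i j k →
    lap G p i j k = -γ * div G ((avg (extrap φprev φcur)).mul (grad G μ)) i j k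

/-- `φ^0, …, φ^M` is a solution of the scheme with time step `s`. -/
structure IsSolution (G : Grid) (ε γ s : ℝ) (M : ℕ) (φ : ℕ → CellFn) : Prop where
  neumann_zero : Neumann G (φ 0)
  neumann_one : Neumann G (φ 1)
  step : ∀ m : ℕ, 1 ≤ m → m + 1 ≤ M →
    ∃ μ p : CellFn, IsStep G ε γ s (φ (m - 1)) (φ m) (φ (m + 1)) μ p

/-- The closed cuboid `[0, Lx] × [0, Ly] × [0, Lz]`. -/
def cuboid (Lx Ly Lz : ℝ) : Set (EuclideanSpace ℝ (Fin 3)) :=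
  {x | ∀ d : Fin 3, 0 ≤ x d ∧ x d ≤ ![Lx, Ly, Lz] d}

/-- `Φ` is three times continuously differentiable up to the boundary of the cuboid, its derivatives
of order at most three are bounded by `R`, and its normal derivative vanishes on the boundary. -/
structure IsRegular (Lx Ly Lz R : ℝ) (Φ : EuclideanSpace ℝ (Fin 3) → ℝ) : Prop where
  contDiffOn : ContDiffOn ℝ 3 Φ (cuboid Lx Ly Lz)
  bound : ∀ n : ℕ, n ≤ 3 → ∀ x ∈ cuboid Lx Ly Lz,
    ‖iteratedFDerivWithin ℝ n Φ (cuboid Lx Ly Lz) x‖ ≤ R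
  neumann : ∀ x ∈ cuboid Lx Ly Lz, ∀ d : Fin 3, (x d = 0 ∨ x d = ![Lx, Ly, Lz] d) →
    fderivWithin ℝ Φ (cuboid Lx Ly Lz) x (EuclideanSpace.single d 1) = 0

/-- `φ` is the grid projection of `Φ`: at the cells it takes the values of `Φ` at the centers. -/
def IsProjection (G : Grid) (Φ : EuclideanSpace ℝ (Fin 3) → ℝ) (φ : CellFn) : Prop :=
  ∀ i j k : ℤ, IsCell G i j k →
    φ i j k = Φ !₂[((i : ℝ) - 1 / 2) * G.h, ((j : ℝ) - 1 / 2) * G.h, ((k : ℝ) - 1 / 2) * G.h]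

end CHHS

/-!
The third-order bound comes from the equation for the chemical potential,
`ε² ∇_h Δ_h (¾ φ^{m+1} + ¼ φ^{m-1}) = ∇_h χ(φ^{m+1}, φ^m) - ∇_h φ_* - ∇_h μ`,
whose three terms on the right are estimated in `L²`.

* `∇_h μ`: testing the phase equation with `μ` and the pressure equation with `p` gives
  `F_h(φ^{m+1}, φ^m) + s ‖∇_h μ‖² ≤ F_h(φ^m, φ^{m-1})` (`IsStep.energy_le`). The work of the pressure
  is at most `γ ‖A_h φ_* ∇_h μ‖²`, which is exactly what the mobility `1 + γ v²` provides, so nothing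
  depends on `γ`. Since `F_h` is bounded below, `s ∑ ‖∇_h μ‖²` is bounded.
* `∇_h φ_*`: since `x⁴ / 4 - x² / 2 ≥ x² / 2 - 1`, a bound of `F_h` bounds the discrete `H¹` norms of
  all time levels (`h1_le_of_modEnergy`).
* `∇_h χ`: it is at most a constant times `max φ² ‖∇_h φ‖`, so the maximum norm is needed. For
  functions bounded in `H¹`, `sup_bound` states `max u² ≤ C_κ + κ ‖∇_h Δ_h u‖` for every `κ > 0`. It
  is proved by applying the one-dimensional inequality of Agmon (`sq_le_sum`) in the three directions
  with different parameters. This needs only the mixed differences `D_x D_y u`, `D_x D_z u`,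
  `D_y D_z u` and `D_x D_y D_z u`; the former are bounded by `‖Δ_h u‖² ≤ ‖∇_h u‖ ‖∇_h Δ_h u‖` and the
  latter by `‖∇_h Δ_h u‖`, because summation by parts turns all mixed products of pure second
  differences into squares (`mixed_le_lap`, `mixed_le_grad_lap`).

With `κ` small, the resulting inequality for one step (`third_order_step`) has a right-hand side whose
third-order part is absorbed after summation over the steps (`sum_le_of_step`). The starting values
contribute `s (‖∇_h Δ_h φ^0‖² + ‖∇_h Δ_h φ^1‖²)`, which is bounded by assumption in the first part.
In the second part it is at most a constant times `T`, because the third differences of grid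
projections are bounded up to the boundary (`IsProjection.gradNormSq_lap_le`): the Neumann condition
makes the second difference with a ghost value consistent with the second derivative
(`abs_second_diff_sub_le`).

Throughout, a grid function with homogeneous Neumann conditions is replaced by its extension
`neumannExt`, which is constant beyond the boundary. This changes neither the scheme nor the norms
(`IsStep.ext`, `modEnergy_ext`), and it makes the difference operators commute for all indices.
-/

namespace CHHS

/-! ### Sums over the cells and difference operators -/

theorem Icc_one_succ (n : ℕ) :
    Finset.Icc (1 : ℤ) ((n + 1 : ℕ) : ℤ) = insert ((n + 1 : ℕ) : ℤ) (Finset.Icc (1 : ℤ) n) := by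
  ext a; simp only [Finset.mem_Icc, Finset.mem_insert]; omega

theorem sum_Icc_sub_shift (N : ℕ) (f : ℤ → ℝ) :
    ∑ i ∈ Finset.Icc (1 : ℤ) N, (f i - f (i - 1)) = f N - f 0 := by
  induction N with
  | zero => simp
  | succ n ih =>
    rw [Icc_one_succ, Finset.sum_insert (by simp), ih]
    push_cast
    rw [add_sub_cancel_right]
    ring

/-- The sum of a grid function over the cells. -/
noncomputable def cellSum (G : Grid) (f : CellFn) : ℝ :=
  ∑ i ∈ Finset.Icc (1 : ℤ) G.Nx, ∑ j ∈ Finset.Icc (1 : ℤ) G.Ny,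
    ∑ k ∈ Finset.Icc (1 : ℤ) G.Nz, f i j k

variable {G : Grid}

theorem cellSum_add (f g : CellFn) : cellSum G (f + g) = cellSum G f + cellSum G g := by
  simp [cellSum, Finset.sum_add_distrib]

theorem cellSum_neg (f : CellFn) : cellSum G (-f) = -cellSum G f := by
  simp [cellSum]

theorem cellSum_sub (f g : CellFn) : cellSum G (f - g) = cellSum G f - cellSum G g := by
  simp [cellSum, Finset.sum_sub_distrib]

theorem cellSum_smul (c : ℝ) (f : CellFn) : cellSum G (c • f) = c * cellSum G f := by
  simp [cellSum, Finset.mul_sum]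

theorem cellSum_mono {f g : CellFn} (h : ∀ i j k, IsCell G i j k → f i j k ≤ g i j k) :
    cellSum G f ≤ cellSum G g :=
  Finset.sum_le_sum fun i hi => Finset.sum_le_sum fun j hj => Finset.sum_le_sum fun k hk =>
    h i j k ⟨Finset.mem_Icc.1 hi, Finset.mem_Icc.1 hj, Finset.mem_Icc.1 hk⟩

theorem cellSum_congr {f g : CellFn} (h : ∀ i j k, IsCell G i j k → f i j k = g i j k) :
    cellSum G f = cellSum G g :=
  le_antisymm (cellSum_mono fun i j k hc => (h i j k hc).le)
    (cellSum_mono fun i j k hc => (h i j k hc).ge)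

theorem cellSum_const (c : ℝ) :
    cellSum G (fun _ _ _ => c) = G.Nx * G.Ny * G.Nz * c := by
  simp [cellSum]; ring

theorem cellSum_nonneg {f : CellFn} (h : ∀ i j k, IsCell G i j k → 0 ≤ f i j k) :
    0 ≤ cellSum G f := by
  have := cellSum_mono (G := G) (f := fun _ _ _ => 0) h
  simpa [cellSum_const] using this

theorem cellSum_mul_self_nonneg (f : CellFn) : 0 ≤ cellSum G (f * f) :=
  cellSum_nonneg fun i j k _ => mul_self_nonneg (f i j k)

/-- Differences along the first direction telescope. -/
theorem cellSum_telescope_x (g : CellFn) (h : ∀ j k, g 0 j k = g G.Nx j k) :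
    cellSum G (fun i j k => g i j k - g (i - 1) j k) = 0 := by
  have := sum_Icc_sub_shift G.Nx (fun i => ∑ j ∈ Finset.Icc (1 : ℤ) G.Ny,
    ∑ k ∈ Finset.Icc (1 : ℤ) G.Nz, g i j k)
  simp only [cellSum, Finset.sum_sub_distrib] at this ⊢
  rw [this]
  simp [h]

theorem cellSum_telescope_y (g : CellFn) (h : ∀ i k, g i 0 k = g i G.Ny k) :
    cellSum G (fun i j k => g i j k - g i (j - 1) k) = 0 := by
  refine Finset.sum_eq_zero fun i _ => ?_
  have := sum_Icc_sub_shift G.Ny (fun j => ∑ k ∈ Finset.Icc (1 : ℤ) G.Nz, g i j k)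
  simp only [Finset.sum_sub_distrib] at this ⊢
  rw [this]
  simp [h]

theorem cellSum_telescope_z (g : CellFn) (h : ∀ i j, g i j 0 = g i j G.Nz) :
    cellSum G (fun i j k => g i j k - g i j (k - 1)) = 0 := by
  refine Finset.sum_eq_zero fun i _ => Finset.sum_eq_zero fun j _ => ?_
  rw [sum_Icc_sub_shift G.Nz (fun k => g i j k), h, sub_self]

/-- Forward difference quotient in the first direction. -/
noncomputable def dx (G : Grid) (u : CellFn) : CellFn := fun i j k =>
  (u (i + 1) j k - u i j k) / G.h

/-- Forward difference quotient in the second direction. -/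
noncomputable def dy (G : Grid) (u : CellFn) : CellFn := fun i j k =>
  (u i (j + 1) k - u i j k) / G.h

/-- Forward difference quotient in the third direction. -/
noncomputable def dz (G : Grid) (u : CellFn) : CellFn := fun i j k =>
  (u i j (k + 1) - u i j k) / G.h

/-- Backward difference quotient in the first direction. -/
noncomputable def backX (G : Grid) (u : CellFn) : CellFn := fun i j k =>
  (u i j k - u (i - 1) j k) / G.h

/-- Backward difference quotient in the second direction. -/
noncomputable def backY (G : Grid) (u : CellFn) : CellFn := fun i j k =>
  (u i j k - u i (j - 1) k) / G.h

/-- Backward difference quotient in the third direction. -/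
noncomputable def backZ (G : Grid) (u : CellFn) : CellFn := fun i j k =>
  (u i j k - u i j (k - 1)) / G.h

/-- The field vanishes on the faces of the boundary orthogonal to the first direction. -/
def VanishX (G : Grid) (f : CellFn) : Prop := ∀ j k, f 0 j k = 0 ∧ f G.Nx j k = 0

/-- The field vanishes on the faces of the boundary orthogonal to the second direction. -/
def VanishY (G : Grid) (f : CellFn) : Prop := ∀ i k, f i 0 k = 0 ∧ f i G.Ny k = 0

/-- The field vanishes on the faces of the boundary orthogonal to the third direction. -/
def VanishZ (G : Grid) (f : CellFn) : Prop := ∀ i j, f i j 0 = 0 ∧ f i j G.Nz = 0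

theorem VanishX.mul_left {f : CellFn} (hf : VanishX G f) (g : CellFn) : VanishX G (g * f) :=
  fun j k => by simp [hf j k]
theorem VanishY.mul_left {f : CellFn} (hf : VanishY G f) (g : CellFn) : VanishY G (g * f) :=
  fun j k => by simp [hf j k]
theorem VanishZ.mul_left {f : CellFn} (hf : VanishZ G f) (g : CellFn) : VanishZ G (g * f) :=
  fun j k => by simp [hf j k]
theorem VanishX.dz {f : CellFn} (hf : VanishX G f) : VanishX G (dz G f) :=
  fun j k => by simp [CHHS.dz, (hf _ _).1, (hf _ _).2]
theorem VanishY.dx {f : CellFn} (hf : VanishY G f) : VanishY G (dx G f) :=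
  fun j k => by simp [CHHS.dx, (hf _ _).1, (hf _ _).2]
theorem VanishY.dz {f : CellFn} (hf : VanishY G f) : VanishY G (dz G f) :=
  fun j k => by simp [CHHS.dz, (hf _ _).1, (hf _ _).2]
theorem VanishZ.dx {f : CellFn} (hf : VanishZ G f) : VanishZ G (dx G f) :=
  fun j k => by simp [CHHS.dx, (hf _ _).1, (hf _ _).2]
theorem VanishZ.dy {f : CellFn} (hf : VanishZ G f) : VanishZ G (dy G f) :=
  fun j k => by simp [CHHS.dy, (hf _ _).1, (hf _ _).2]
theorem VanishX.backZ {f : CellFn} (hf : VanishX G f) : VanishX G (backZ G f) :=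
  fun j k => by simp [CHHS.backZ, (hf _ _).1, (hf _ _).2]
theorem VanishY.backZ {f : CellFn} (hf : VanishY G f) : VanishY G (backZ G f) :=
  fun j k => by simp [CHHS.backZ, (hf _ _).1, (hf _ _).2]
theorem VanishZ.backX {f : CellFn} (hf : VanishZ G f) : VanishZ G (backX G f) :=
  fun j k => by simp [CHHS.backX, (hf _ _).1, (hf _ _).2]
theorem VanishZ.backY {f : CellFn} (hf : VanishZ G f) : VanishZ G (backY G f) :=
  fun j k => by simp [CHHS.backY, (hf _ _).1, (hf _ _).2]

/-- Summation by parts in the first direction. -/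
theorem cellSum_backX_mul {f : CellFn} (hf : VanishX G f) (u : CellFn) :
    cellSum G (backX G f * u) = -cellSum G (f * dx G u) := by
  have h := cellSum_telescope_x (G := G) (fun i j k => f i j k * u (i + 1) j k / G.h)
    (fun j k => by simp [hf j k])
  rw [← cellSum_neg, ← sub_eq_zero, ← cellSum_sub, ← h]
  congr 1
  funext i j k
  simp only [backX, dx, Pi.sub_apply, Pi.mul_apply, Pi.neg_apply, sub_add_cancel]
  ring

/-- Summation by parts in the second direction. -/
theorem cellSum_backY_mul {f : CellFn} (hf : VanishY G f) (u : CellFn) :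
    cellSum G (backY G f * u) = -cellSum G (f * dy G u) := by
  have h := cellSum_telescope_y (G := G) (fun i j k => f i j k * u i (j + 1) k / G.h)
    (fun j k => by simp [hf j k])
  rw [← cellSum_neg, ← sub_eq_zero, ← cellSum_sub, ← h]
  congr 1
  funext i j k
  simp only [backY, dy, Pi.sub_apply, Pi.mul_apply, Pi.neg_apply, sub_add_cancel]
  ring

/-- Summation by parts in the third direction. -/
theorem cellSum_backZ_mul {f : CellFn} (hf : VanishZ G f) (u : CellFn) :
    cellSum G (backZ G f * u) = -cellSum G (f * dz G u) := by
  have h := cellSum_telescope_z (G := G) (fun i j k => f i j k * u i j (k + 1) / G.h)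
    (fun j k => by simp [hf j k])
  rw [← cellSum_neg, ← sub_eq_zero, ← cellSum_sub, ← h]
  congr 1
  funext i j k
  simp only [backZ, dz, Pi.sub_apply, Pi.mul_apply, Pi.neg_apply, sub_add_cancel]
  ring

/-! ### Functions extended by the boundary conditions -/

/-- The values of `u` outside the cells are those of `neumannExt`. For such functions the boundary
conditions hold along whole lines, so that difference operators in different directions commute
without regard to the range of the indices. -/
def IsExt (G : Grid) (u : CellFn) : Prop := neumannExt G u = u

theorem clamp_eq {N : ℕ} {i : ℤ} (h : 1 ≤ i ∧ i ≤ N) : max 1 (min i (N : ℤ)) = i := by omega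

theorem clamp_mem {N : ℕ} (hN : 0 < N) (i : ℤ) :
    1 ≤ max 1 (min i (N : ℤ)) ∧ max 1 (min i (N : ℤ)) ≤ N := by omega

/-- There is a cell in each direction, and the spatial step is positive. -/
structure Grid.Pos (G : Grid) : Prop where
  x : 0 < G.Nx
  y : 0 < G.Ny
  z : 0 < G.Nz
  h : 0 < G.h

theorem Grid.Discretizes.pos {Lx Ly Lz : ℝ} (hG : G.Discretizes Lx Ly Lz) (hLx : 0 < Lx) : G.Pos :=
  ⟨hG.1, hG.2, hG.3, by rw [hG.h_eq_x]; have := hG.1; positivity⟩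

theorem neumannExt_apply {u : CellFn} {i j k : ℤ} (h : IsCell G i j k) :
    neumannExt G u i j k = u i j k := by
  simp only [neumannExt, clamp_eq h.1, clamp_eq h.2.1, clamp_eq h.2.2]

theorem isCell_clamp (hG : G.Pos) (i j k : ℤ) :
    IsCell G (max 1 (min i G.Nx)) (max 1 (min j G.Ny)) (max 1 (min k G.Nz)) :=
  ⟨clamp_mem hG.x i, clamp_mem hG.y j, clamp_mem hG.z k⟩

theorem neumannExt_congr (hG : G.Pos) {u v : CellFn}
    (h : ∀ i j k, IsCell G i j k → u i j k = v i j k) : neumannExt G u = neumannExt G v := by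
  funext i j k
  exact h _ _ _ (isCell_clamp hG i j k)

theorem isExt_neumannExt (hG : G.Pos) (u : CellFn) : IsExt G (neumannExt G u) :=
  neumannExt_congr hG fun _ _ _ h => neumannExt_apply h

theorem IsExt.ext (hG : G.Pos) {u v : CellFn} (hu : IsExt G u) (hv : IsExt G v)
    (h : ∀ i j k, IsCell G i j k → u i j k = v i j k) : u = v := by
  rw [← hu, ← hv]; exact neumannExt_congr hG h

theorem isExt_lap (hG : G.Pos) (u : CellFn) : IsExt G (lap G u) := isExt_neumannExt hG _

theorem IsExt.comp₂ {u v : CellFn} (hu : IsExt G u) (hv : IsExt G v) (F : ℝ → ℝ → ℝ) :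
    IsExt G (fun i j k => F (u i j k) (v i j k)) := by
  funext i j k
  exact congrArg₂ F (congrFun (congrFun (congrFun hu i) j) k)
    (congrFun (congrFun (congrFun hv i) j) k)

theorem IsExt.add {u v : CellFn} (hu : IsExt G u) (hv : IsExt G v) : IsExt G (u + v) :=
  hu.comp₂ hv (· + ·)
theorem IsExt.sub {u v : CellFn} (hu : IsExt G u) (hv : IsExt G v) : IsExt G (u - v) :=
  hu.comp₂ hv (· - ·)
theorem IsExt.smul {u : CellFn} (hu : IsExt G u) (c : ℝ) : IsExt G (c • u) :=
  hu.comp₂ hu (fun a _ => c * a)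

theorem IsExt.vanishX {u : CellFn} (hu : IsExt G u) (hG : G.Pos) : VanishX G (dx G u) := by
  intro j k
  have hx := hG.x
  constructor <;> simp only [dx] <;> rw [← hu] <;> simp only [neumannExt] <;>
    rw [div_eq_zero_iff, sub_eq_zero] <;> left <;> congr 1 <;> omega

theorem IsExt.vanishY {u : CellFn} (hu : IsExt G u) (hG : G.Pos) : VanishY G (dy G u) := by
  intro j k
  have hx := hG.y
  constructor <;> simp only [dy] <;> rw [← hu] <;> simp only [neumannExt] <;>
    rw [div_eq_zero_iff, sub_eq_zero] <;> left <;> congr 1 <;> omega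

theorem IsExt.vanishZ {u : CellFn} (hu : IsExt G u) (hG : G.Pos) : VanishZ G (dz G u) := by
  intro j k
  have hx := hG.z
  constructor <;> simp only [dz] <;> rw [← hu] <;> simp only [neumannExt] <;>
    rw [div_eq_zero_iff, sub_eq_zero] <;> left <;> congr 1 <;> omega

/-! ### The discrete norms -/

theorem cellSum_half_x (f : CellFn) (hf : ∀ j k, f 0 j k = f G.Nx j k) :
    cellSum G (fun i j k => f i j k + f (i - 1) j k) = 2 * cellSum G f := by
  have h := cellSum_telescope_x f hf
  rw [← sub_eq_zero, ← cellSum_smul, ← cellSum_sub, ← neg_eq_zero, ← cellSum_neg, ← h]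
  congr 1; funext i j k; simp; ring

theorem cellSum_half_y (f : CellFn) (hf : ∀ i k, f i 0 k = f i G.Ny k) :
    cellSum G (fun i j k => f i j k + f i (j - 1) k) = 2 * cellSum G f := by
  have h := cellSum_telescope_y f hf
  rw [← sub_eq_zero, ← cellSum_smul, ← cellSum_sub, ← neg_eq_zero, ← cellSum_neg, ← h]
  congr 1; funext i j k; simp; ring

theorem cellSum_half_z (f : CellFn) (hf : ∀ i j, f i j 0 = f i j G.Nz) :
    cellSum G (fun i j k => f i j k + f i j (k - 1)) = 2 * cellSum G f := by
  have h := cellSum_telescope_z f hf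
  rw [← sub_eq_zero, ← cellSum_smul, ← cellSum_sub, ← neg_eq_zero, ← cellSum_neg, ← h]
  congr 1; funext i j k; simp; ring

/-- The discrete inner product `h³ ∑ f g`, where `f` and `g` are both cell-centered or both
components of face-centered fields; the face `i + 1/2` is attached to the cell `i`, so the face on
the left part of the boundary is left out. -/
noncomputable def ip (G : Grid) (f g : CellFn) : ℝ := G.h ^ 3 * cellSum G (f * g)

theorem ip_comm (f g : CellFn) : ip G f g = ip G g f := by rw [ip, ip, mul_comm f g]
theorem ip_add_left (f g u : CellFn) : ip G (f + g) u = ip G f u + ip G g u := by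
  simp only [ip, add_mul, cellSum_add, mul_add]
theorem ip_sub_left (f g u : CellFn) : ip G (f - g) u = ip G f u - ip G g u := by
  simp only [ip, sub_mul, cellSum_sub, mul_sub]
theorem ip_smul_left (c : ℝ) (f u : CellFn) : ip G (c • f) u = c * ip G f u := by
  simp only [ip, smul_mul_assoc, cellSum_smul]; ring
theorem ip_add_right (f g u : CellFn) : ip G u (f + g) = ip G u f + ip G u g := by
  simp only [ip, mul_add, cellSum_add]
theorem ip_sub_right (f g u : CellFn) : ip G u (f - g) = ip G u f - ip G u g := by
  simp only [ip, mul_sub, cellSum_sub]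
theorem ip_smul_right (c : ℝ) (f u : CellFn) : ip G u (c • f) = c * ip G u f := by
  simp only [ip, mul_smul_comm, cellSum_smul]; ring

theorem ip_self_nonneg (hG : G.Pos) (f : CellFn) : 0 ≤ ip G f f :=
  mul_nonneg (pow_nonneg hG.h.le 3) (cellSum_mul_self_nonneg f)

/-- The Cauchy–Schwarz inequality with a weight. -/
theorem ip_le (hG : G.Pos) (f g : CellFn) {t : ℝ} (ht : 0 < t) :
    ip G f g ≤ t / 2 * ip G f f + 1 / (2 * t) * ip G g g := by
  have h := ip_self_nonneg hG (t • f - g)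
  simp only [ip_sub_left, ip_sub_right, ip_smul_left, ip_smul_right, ip_comm g f] at h
  have e : t / 2 * ip G f f + 1 / (2 * t) * ip G g g - ip G f g
      = 1 / (2 * t) * (t * (t * ip G f f) - t * ip G f g - (t * ip G f g - ip G g g)) := by
    field_simp; ring
  have : 0 ≤ 1 / (2 * t) * (t * (t * ip G f f) - t * ip G f g - (t * ip G f g - ip G g g)) := by
    exact mul_nonneg (by positivity) (by linarith)
  linarith

theorem ip_backX (f u : CellFn) (hf : VanishX G f) : ip G (backX G f) u = -ip G f (dx G u) := by
  rw [ip, cellSum_backX_mul hf, ip]; ring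
theorem ip_backY (f u : CellFn) (hf : VanishY G f) : ip G (backY G f) u = -ip G f (dy G u) := by
  rw [ip, cellSum_backY_mul hf, ip]; ring
theorem ip_backZ (f u : CellFn) (hf : VanishZ G f) : ip G (backZ G f) u = -ip G f (dz G u) := by
  rw [ip, cellSum_backZ_mul hf, ip]; ring

/-- `∇_h u · ∇_h v` integrated over the cuboid. -/
noncomputable def gradIp (G : Grid) (u v : CellFn) : ℝ :=
  ip G (dx G u) (dx G v) + ip G (dy G u) (dy G v) + ip G (dz G u) (dz G v)

theorem faceInner_grad (hG : G.Pos) {u v : CellFn} (hv : IsExt G v) :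
    faceInner G (grad G u) (grad G v) = gradIp G u v := by
  have h1 := cellSum_half_x (G := G) (dx G u * dx G v) (fun j k => by
    simp [hv.vanishX hG j k])
  have h2 := cellSum_half_y (G := G) (dy G u * dy G v) (fun j k => by
    simp [hv.vanishY hG j k])
  have h3 := cellSum_half_z (G := G) (dz G u * dz G v) (fun j k => by
    simp [hv.vanishZ hG j k])
  have h0 : faceInner G (grad G u) (grad G v) =
    (1 / 2) * G.h ^ 3 * cellSum G (fun i j k => (dx G u * dx G v) i j k + (dx G u * dx G v) (i-1) j k)
    + (1 / 2) * G.h ^ 3 * cellSum G (fun i j k => (dy G u * dy G v) i j k + (dy G u * dy G v) i (j-1) k)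
    + (1 / 2) * G.h ^ 3 * cellSum G (fun i j k => (dz G u * dz G v) i j k + (dz G u * dz G v) i j (k-1)) :=
    rfl
  rw [h0, h1, h2, h3, gradIp, ip, ip, ip]
  ring

theorem gradNormSq_eq (hG : G.Pos) {u : CellFn} (hu : IsExt G u) :
    gradNormSq G u = gradIp G u u := faceInner_grad hG hu

theorem normPow_two (u : CellFn) : normPow G 2 u = ip G u u := by
  have : normPow G 2 u = G.h ^ 3 * cellSum G (fun i j k => |u i j k| ^ 2 * 1) := rfl
  rw [this, ip]; congr 2; funext i j k; simp [sq]

theorem normPow_four (u : CellFn) : normPow G 4 u = ip G (u * u) (u * u) := by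
  have : normPow G 4 u = G.h ^ 3 * cellSum G (fun i j k => |u i j k| ^ 4 * 1) := rfl
  rw [this, ip]; congr 2; funext i j k
  have : |u i j k| ^ 4 = (|u i j k| ^ 2) ^ 2 := by ring
  simp [this, sq]

theorem dx_add (u v : CellFn) : dx G (u + v) = dx G u + dx G v := by
  funext i j k; simp [dx]; ring
theorem dy_add (u v : CellFn) : dy G (u + v) = dy G u + dy G v := by
  funext i j k; simp [dy]; ring
theorem dz_add (u v : CellFn) : dz G (u + v) = dz G u + dz G v := by
  funext i j k; simp [dz]; ring
theorem dx_sub (u v : CellFn) : dx G (u - v) = dx G u - dx G v := by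
  funext i j k; simp [dx]; ring
theorem dy_sub (u v : CellFn) : dy G (u - v) = dy G u - dy G v := by
  funext i j k; simp [dy]; ring
theorem dz_sub (u v : CellFn) : dz G (u - v) = dz G u - dz G v := by
  funext i j k; simp [dz]; ring
theorem dx_smul (c : ℝ) (u : CellFn) : dx G (c • u) = c • dx G u := by
  funext i j k; simp [dx]; ring
theorem dy_smul (c : ℝ) (u : CellFn) : dy G (c • u) = c • dy G u := by
  funext i j k; simp [dy]; ring
theorem dz_smul (c : ℝ) (u : CellFn) : dz G (c • u) = c • dz G u := by
  funext i j k; simp [dz]; ring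

theorem gradIp_comm (u v : CellFn) : gradIp G u v = gradIp G v u := by
  simp only [gradIp, ip_comm]
theorem gradIp_add_left (f g u : CellFn) : gradIp G (f + g) u = gradIp G f u + gradIp G g u := by
  simp only [gradIp, dx_add, dy_add, dz_add, ip_add_left]; ring
theorem gradIp_sub_left (f g u : CellFn) : gradIp G (f - g) u = gradIp G f u - gradIp G g u := by
  simp only [gradIp, dx_sub, dy_sub, dz_sub, ip_sub_left]; ring
theorem gradIp_smul_left (c : ℝ) (f u : CellFn) : gradIp G (c • f) u = c * gradIp G f u := by
  simp only [gradIp, dx_smul, dy_smul, dz_smul, ip_smul_left]; ring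
theorem gradIp_add_right (f g u : CellFn) : gradIp G u (f + g) = gradIp G u f + gradIp G u g := by
  simp only [gradIp, dx_add, dy_add, dz_add, ip_add_right]; ring
theorem gradIp_sub_right (f g u : CellFn) : gradIp G u (f - g) = gradIp G u f - gradIp G u g := by
  simp only [gradIp, dx_sub, dy_sub, dz_sub, ip_sub_right]; ring
theorem gradIp_smul_right (c : ℝ) (f u : CellFn) : gradIp G u (c • f) = c * gradIp G u f := by
  simp only [gradIp, dx_smul, dy_smul, dz_smul, ip_smul_right]; ring

theorem gradIp_self_nonneg (hG : G.Pos) (u : CellFn) : 0 ≤ gradIp G u u :=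
  add_nonneg (add_nonneg (ip_self_nonneg hG _) (ip_self_nonneg hG _)) (ip_self_nonneg hG _)

theorem gradIp_le (hG : G.Pos) (u v : CellFn) {t : ℝ} (ht : 0 < t) :
    gradIp G u v ≤ t / 2 * gradIp G u u + 1 / (2 * t) * gradIp G v v := by
  have h1 := ip_le hG (dx G u) (dx G v) ht
  have h2 := ip_le hG (dy G u) (dy G v) ht
  have h3 := ip_le hG (dz G u) (dz G v) ht
  simp only [gradIp]
  linarith

/-- The divergence theorem for the discrete operators: fields that vanish on the boundary faces. -/
theorem ip_div (F : FaceField) (u : CellFn) (hx : VanishX G F.x) (hy : VanishY G F.y)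
    (hz : VanishZ G F.z) :
    ip G (div G F) u = -(ip G F.x (dx G u) + ip G F.y (dy G u) + ip G F.z (dz G u)) := by
  have : div G F = backX G F.x + backY G F.y + backZ G F.z := rfl
  rw [this, ip_add_left, ip_add_left, ip_backX _ _ hx, ip_backY _ _ hy, ip_backZ _ _ hz]
  ring

theorem ip_congr_left {f g : CellFn} (u : CellFn) (h : ∀ i j k, IsCell G i j k → f i j k = g i j k) :
    ip G f u = ip G g u := by
  rw [ip, ip]; congr 1
  exact cellSum_congr fun i j k hc => by simp [h i j k hc]

/-- Green's formula for the discrete Laplacian. -/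
theorem ip_lap (hG : G.Pos) {u : CellFn} (hu : IsExt G u) (v : CellFn) :
    ip G (lap G u) v = -gradIp G u v := by
  rw [ip_congr_left (f := lap G u) (g := div G (grad G u)) v fun i j k h => neumannExt_apply h,
    ip_div _ _ (hu.vanishX hG) (hu.vanishY hG) (hu.vanishZ hG)]
  rfl

theorem lap_add (u v : CellFn) : lap G (u + v) = lap G u + lap G v := by
  funext i j k; simp [lap, neumannExt, div, grad]; ring
theorem lap_smul (c : ℝ) (u : CellFn) : lap G (c • u) = c • lap G u := by
  funext i j k; simp [lap, neumannExt, div, grad]; ring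

/-! ### Energy stability -/

theorem extrap_eq (a b : CellFn) : extrap a b = (3 / 2 : ℝ) • b - (1 / 2 : ℝ) • a := rfl

theorem isExt_extrap {a b : CellFn} (ha : IsExt G a) (hb : IsExt G b) : IsExt G (extrap a b) :=
  (hb.smul _).sub (ha.smul _)

theorem isExt_chi {a b : CellFn} (ha : IsExt G a) (hb : IsExt G b) : IsExt G (chi a b) :=
  ha.comp₂ hb (fun x y => (1 / 4) * (x ^ 2 + y ^ 2) * (x + y))

/-- The equation for the chemical potential, as an identity of extended functions. -/
theorem IsStep.mu_eq {ε γ s : ℝ} {a b c μ p : CellFn} (hG : G.Pos)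
    (hs : IsStep G ε γ s a b c μ p) (ha : IsExt G a) (hb : IsExt G b) (hc : IsExt G c)
    (hμ : IsExt G μ) :
    μ = chi c b - extrap a b - ε ^ 2 • lap G ((3 / 4 : ℝ) • c + (1 / 4 : ℝ) • a) :=
  hμ.ext hG (((isExt_chi hc hb).sub (isExt_extrap ha hb)).sub ((isExt_lap hG _).smul _))
    hs.eq_mu

theorem modEnergy_eq (hG : G.Pos) (ε : ℝ) {u v : CellFn} (hu : IsExt G u) (hv : IsExt G v) :
    modEnergy G ε u v = 1 / 4 * ip G (u * u) (u * u) - 1 / 2 * ip G u u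
      + ε ^ 2 / 2 * gradIp G u u + 1 / 4 * ip G (u - v) (u - v)
      + 1 / 8 * ε ^ 2 * gradIp G (u - v) (u - v) := by
  rw [modEnergy, energy, normPow_two, normPow_two, normPow_four, gradNormSq_eq hG hu,
    gradNormSq_eq hG (hu.sub hv)]

/-- Testing the equation for the phase variable with the chemical potential: the work of the
pressure is absorbed by the part `γ v²` of the mobility, so that the dissipation is controlled
uniformly in `γ`. -/
theorem IsStep.dissipation {ε γ s : ℝ} {a b c μ p : CellFn} (hG : G.Pos) (hγ : 0 < γ) (hs0 : 0 ≤ s)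
    (hs : IsStep G ε γ s a b c μ p) (hμ : IsExt G μ) (hp : IsExt G p) :
    ip G (c - b) μ ≤ -(s * gradIp G μ μ) := by
  set A := avg (extrap a b) with hA
  have e1 : ip G (c - b) μ = ip G (s • div G ((A.comp (fun v => 1 + γ * v ^ 2)).mul (grad G μ))
      + s • div G (A.mul (grad G p))) μ := ip_congr_left _ hs.eq_phi
  have e2 : ip G (lap G p) p = ip G ((-γ) • div G (A.mul (grad G μ))) p :=
    ip_congr_left _ hs.eq_p
  rw [ip_lap hG hp, ip_smul_left, ip_div _ _ ((hμ.vanishX hG).mul_left _)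
    ((hμ.vanishY hG).mul_left _) ((hμ.vanishZ hG).mul_left _)] at e2
  rw [ip_add_left, ip_smul_left, ip_smul_left, ip_div _ _ ((hμ.vanishX hG).mul_left _)
    ((hμ.vanishY hG).mul_left _) ((hμ.vanishZ hG).mul_left _), ip_div _ _ ((hp.vanishX hG).mul_left _)
    ((hp.vanishY hG).mul_left _) ((hp.vanishZ hG).mul_left _)] at e1
  -- `k1` splits the mobility, and `k3` is `‖P + γ Q‖² ≥ 0`; with the pressure equation in the form
  -- `‖P‖² = -γ (Q, P)` for `P = ∇_h p` and `Q = A_h φ_* ∇_h μ`, it yields `-(Q, P) ≤ γ ‖Q‖²`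
  have k1 : ∀ α M : CellFn, ip G (fun i j k => (1 + γ * α i j k ^ 2) * M i j k) M
      = ip G M M + γ * ip G (α * M) (α * M) := by
    intro α M
    rw [← ip_smul_left, ip, ip, ip, ← mul_add, ← cellSum_add]
    congr 2; funext i j k; simp; ring
  have k2 : ∀ α P M : CellFn, ip G (α * P) M = ip G (α * M) P := by
    intro α P M
    rw [ip, ip]; congr 2; ring
  have k3 : ∀ Q P : CellFn, 0 ≤ ip G P P + 2 * γ * ip G Q P + γ ^ 2 * ip G Q Q := by
    intro Q P
    have := ip_self_nonneg hG (P + γ • Q)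
    simp only [ip_add_left, ip_add_right, ip_smul_left, ip_smul_right, ip_comm P Q] at this
    linarith
  have x1 : ip G ((A.comp (fun v => 1 + γ * v ^ 2)).mul (grad G μ)).x (dx G μ) = _ :=
    k1 A.x (dx G μ)
  have y1 : ip G ((A.comp (fun v => 1 + γ * v ^ 2)).mul (grad G μ)).y (dy G μ) = _ :=
    k1 A.y (dy G μ)
  have z1 : ip G ((A.comp (fun v => 1 + γ * v ^ 2)).mul (grad G μ)).z (dz G μ) = _ :=
    k1 A.z (dz G μ)
  have x2 : ip G (A.mul (grad G p)).x (dx G μ) = _ := k2 A.x (dx G p) (dx G μ)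
  have y2 : ip G (A.mul (grad G p)).y (dy G μ) = _ := k2 A.y (dy G p) (dy G μ)
  have z2 : ip G (A.mul (grad G p)).z (dz G μ) = _ := k2 A.z (dz G p) (dz G μ)
  rw [x1, y1, z1, x2, y2, z2] at e1
  have x3 := k3 (A.x * dx G μ) (dx G p)
  have y3 := k3 (A.y * dy G μ) (dy G p)
  have z3 := k3 (A.z * dz G μ) (dz G p)
  have x4 : ip G (A.mul (grad G μ)).x (dx G p) = ip G (A.x * dx G μ) (dx G p) := rfl
  have y4 : ip G (A.mul (grad G μ)).y (dy G p) = ip G (A.y * dy G μ) (dy G p) := rfl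
  have z4 : ip G (A.mul (grad G μ)).z (dz G p) = ip G (A.z * dz G μ) (dz G p) := rfl
  rw [x4, y4, z4] at e2
  rw [e1]
  simp only [gradIp] at e2 ⊢
  set q := ip G (A.x * dx G μ) (dx G p) + ip G (A.y * dy G μ) (dy G p)
    + ip G (A.z * dz G μ) (dz G p)
  set r := ip G (A.x * dx G μ) (A.x * dx G μ) + ip G (A.y * dy G μ) (A.y * dy G μ)
    + ip G (A.z * dz G μ) (A.z * dz G μ)
  have h5 : 0 ≤ γ * (q + γ * r) := by simp only [q, r]; linarith
  have h6 : 0 ≤ s * (q + γ * r) := mul_nonneg hs0 (nonneg_of_mul_nonneg_right h5 hγ)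
  simp only [q, r] at h6 ⊢
  linarith

/-- The modified energy decreases, and its decrease controls the gradient of the chemical
potential. -/
theorem IsStep.energy_le {ε γ s : ℝ} {a b c μ p : CellFn} (hG : G.Pos) (hγ : 0 < γ) (hs0 : 0 ≤ s)
    (hs : IsStep G ε γ s a b c μ p) (ha : IsExt G a) (hb : IsExt G b) (hc : IsExt G c)
    (hμ : IsExt G μ) (hp : IsExt G p) :
    modEnergy G ε c b + s * gradIp G μ μ ≤ modEnergy G ε b a := by
  have h1 := hs.dissipation hG hγ hs0 hμ hp
  rw [modEnergy_eq hG ε hc hb, modEnergy_eq hG ε hb ha]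
  have h2 : ip G (c - b) (chi c b) = 1 / 4 * ip G (c * c) (c * c) - 1 / 4 * ip G (b * b) (b * b) := by
    rw [← ip_smul_left, ← ip_smul_left, ip, ip, ip, ← mul_sub, ← cellSum_sub]
    congr 2; funext i j k; simp [chi]; ring
  have h3 : ip G (c - b) μ = _ := congrArg (ip G (c - b)) (hs.mu_eq hG ha hb hc hμ)
  rw [ip_sub_right, ip_sub_right, h2, extrap_eq, ip_smul_right, ip_comm (c - b) (lap G _),
    ip_lap hG ((hc.smul _).add (ha.smul _))] at h3
  -- the defect in the energy inequality is a sum of squares of the second time difference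
  have h4 := ip_self_nonneg hG (c - (2 : ℝ) • b + a)
  have h5 := mul_nonneg (sq_nonneg ε) (gradIp_self_nonneg hG (c - (2 : ℝ) • b + a))
  simp only [ip_add_left, ip_add_right, ip_sub_left, ip_sub_right, ip_smul_left, ip_smul_right,
    gradIp_add_left, gradIp_add_right, gradIp_sub_left, gradIp_sub_right, gradIp_smul_left,
    gradIp_smul_right, ip_comm b a, ip_comm c a, ip_comm c b, gradIp_comm b a, gradIp_comm c a,
    gradIp_comm c b] at h1 h3 h4 h5 ⊢
  linarith

/-- The modified energy controls the discrete `H¹` norm, since `x⁴ / 4 - x² / 2 ≥ x² / 2 - 1`. -/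
theorem modEnergy_ge (hG : G.Pos) (ε : ℝ) {u v : CellFn} (hu : IsExt G u) (hv : IsExt G v) :
    1 / 2 * ip G u u + ε ^ 2 / 2 * gradIp G u u + 1 / 4 * ip G (u - v) (u - v)
      + 1 / 8 * ε ^ 2 * gradIp G (u - v) (u - v) - G.h ^ 3 * (G.Nx * G.Ny * G.Nz)
      ≤ modEnergy G ε u v := by
  rw [modEnergy_eq hG ε hu hv]
  have h1 : 0 ≤ 1 / 4 * ip G (u * u) (u * u) - ip G u u + G.h ^ 3 * (G.Nx * G.Ny * G.Nz) := by
    have e : 1 / 4 * ip G (u * u) (u * u) - ip G u u + G.h ^ 3 * (G.Nx * G.Ny * G.Nz)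
        = ip G ((1 / 2 : ℝ) • (u * u) - 1) ((1 / 2 : ℝ) • (u * u) - 1) := by
      have e1 : ip G 1 1 = G.h ^ 3 * (G.Nx * G.Ny * G.Nz) := by
        have := cellSum_const (G := G) 1
        rw [mul_one] at this
        rw [ip, ← this]; congr 2; funext i j k; simp
      have e2 : ip G (u * u) 1 = ip G u u := by rw [ip, ip, mul_one]
      simp only [ip_sub_left, ip_sub_right, ip_smul_left, ip_smul_right, ip_comm 1 (u * u), e1, e2]
      ring
    rw [e]; exact ip_self_nonneg hG _
  linarith

/-! ### Mixed difference quotients -/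

/-- Integrating by parts twice, the product of two pure second differences in different directions
becomes the square of the mixed one. -/
theorem ip_xx_yy (g : CellFn) (hx : VanishX G (dx G g)) (hy : VanishY G (dy G g)) :
    ip G (backX G (dx G g)) (backY G (dy G g)) = ip G (dy G (dx G g)) (dy G (dx G g)) := by
  have c1 : dx G (backY G (dy G g)) = backY G (dy G (dx G g)) := by
    funext i j k; simp only [dx, dy, backY]; ring
  have c2 : dy G (dx G g) = dx G (dy G g) := by
    funext i j k; simp only [dx, dy]; ring
  rw [ip_backX _ _ hx, c1, ip_comm, ip_backY _ _ (by rw [c2]; exact hy.dx), neg_neg]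

theorem ip_xx_zz (g : CellFn) (hx : VanishX G (dx G g)) (hz : VanishZ G (dz G g)) :
    ip G (backX G (dx G g)) (backZ G (dz G g)) = ip G (dz G (dx G g)) (dz G (dx G g)) := by
  have c1 : dx G (backZ G (dz G g)) = backZ G (dz G (dx G g)) := by
    funext i j k; simp only [dx, dz, backZ]; ring
  have c2 : dz G (dx G g) = dx G (dz G g) := by
    funext i j k; simp only [dx, dz]; ring
  rw [ip_backX _ _ hx, c1, ip_comm, ip_backZ _ _ (by rw [c2]; exact hz.dx), neg_neg]

theorem ip_yy_zz (g : CellFn) (hy : VanishY G (dy G g)) (hz : VanishZ G (dz G g)) :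
    ip G (backY G (dy G g)) (backZ G (dz G g)) = ip G (dz G (dy G g)) (dz G (dy G g)) := by
  have c1 : dy G (backZ G (dz G g)) = backZ G (dz G (dy G g)) := by
    funext i j k; simp only [dy, dz, backZ]; ring
  have c2 : dz G (dy G g) = dy G (dz G g) := by
    funext i j k; simp only [dy, dz]; ring
  rw [ip_backY _ _ hy, c1, ip_comm, ip_backZ _ _ (by rw [c2]; exact hz.dy), neg_neg]

theorem ip_self_congr {f g : CellFn} (h : ∀ i j k, IsCell G i j k → f i j k = g i j k) :
    ip G f f = ip G g g := by
  rw [ip_congr_left f h, ip_comm, ip_congr_left g h]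

/-- The Laplacian controls the mixed second differences. -/
theorem mixed_le_lap (hG : G.Pos) {u : CellFn} (hu : IsExt G u) :
    2 * (ip G (dy G (dx G u)) (dy G (dx G u)) + ip G (dz G (dx G u)) (dz G (dx G u))
      + ip G (dz G (dy G u)) (dz G (dy G u))) ≤ ip G (lap G u) (lap G u) := by
  have hx := hu.vanishX hG
  have hy := hu.vanishY hG
  have hz := hu.vanishZ hG
  rw [ip_self_congr (f := lap G u)
    (g := backX G (dx G u) + backY G (dy G u) + backZ G (dz G u))
    fun i j k h => neumannExt_apply h]
  have h1 := ip_self_nonneg hG (backX G (dx G u))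
  have h2 := ip_self_nonneg hG (backY G (dy G u))
  have h3 := ip_self_nonneg hG (backZ G (dz G u))
  simp only [ip_add_left, ip_add_right, ip_comm (backY G (dy G u)) (backX G (dx G u)),
    ip_comm (backZ G (dz G u)) (backX G (dx G u)), ip_comm (backZ G (dz G u)) (backY G (dy G u)),
    ip_xx_yy u hx hy, ip_xx_zz u hx hz, ip_yy_zz u hy hz]
  linarith

/-- The gradient of the Laplacian controls the third difference that is mixed in all directions.
Of the mixed products in `‖D_z Δ_h u‖²`, that of `D_z D_x²` and `D_z D_y²` is its square, and the
other two are squares as well. -/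
theorem mixed_le_grad_lap (hG : G.Pos) {u : CellFn} (hu : IsExt G u) :
    2 * ip G (dz G (dy G (dx G u))) (dz G (dy G (dx G u))) ≤ gradIp G (lap G u) (lap G u) := by
  have hx := hu.vanishX hG
  have hy := hu.vanishY hG
  have hz := hu.vanishZ hG
  set v := backZ G (dz G u) with hv
  set c := neumannExt G v with hc
  have hcell : ∀ i j k, IsCell G i j k →
      dz G (lap G u) i j k
        = (backX G (dx G (dz G u)) + backY G (dy G (dz G u)) + dz G c) i j k := by
    intro i j k h
    have hl : ∀ l : ℤ, lap G u i j l
        = backX G (dx G u) i j l + backY G (dy G u) i j l + c i j l := by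
      intro l
      have e : ∀ m n, u m n (max 1 (min l (G.Nz : ℤ))) = u m n l := by
        intro m n
        have hl' : max 1 (min (max 1 (min l (G.Nz : ℤ))) (G.Nz : ℤ)) = max 1 (min l (G.Nz : ℤ)) :=
          clamp_eq (clamp_mem hG.z l)
        rw [← hu]; simp only [neumannExt, hl']
      have e1 : lap G u i j l = backX G (dx G u) i j (max 1 (min l (G.Nz : ℤ)))
          + backY G (dy G u) i j (max 1 (min l (G.Nz : ℤ))) + c i j l := by
        simp only [lap, hc, neumannExt, clamp_eq h.1, clamp_eq h.2.1]; rfl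
      rw [e1]
      simp only [backX, backY, dx, dy, e]
    simp only [dz, hl, Pi.add_apply, backX, backY, dx, dy]
    ring
  have hA : backX G (dx G (dz G u)) = dz G (backX G (dx G u)) := by
    funext i j k; simp only [dx, dz, backX]; ring
  have hB : backY G (dy G (dz G u)) = dz G (backY G (dy G u)) := by
    funext i j k; simp only [dy, dz, backY]; ring
  have hA' : backZ G (backX G (dx G (dz G u))) = backX G (dx G v) := by
    funext i j k; simp only [hv, dx, dz, backX, backZ]; ring
  have hB' : backZ G (backY G (dy G (dz G u))) = backY G (dy G v) := by
    funext i j k; simp only [hv, dy, dz, backY, backZ]; ring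
  have hxv : VanishX G (dx G v) := by
    have : dx G v = backZ G (dz G (dx G u)) := by
      funext i j k; simp only [hv, dx, dz, backZ]; ring
    rw [this]; exact hx.dz.backZ
  have hyv : VanishY G (dy G v) := by
    have : dy G v = backZ G (dz G (dy G u)) := by
      funext i j k; simp only [hv, dy, dz, backZ]; ring
    rw [this]; exact hy.dz.backZ
  have hcv : ∀ w, ip G w c = ip G v w := fun w => by
    rw [ip_comm, ip_congr_left w fun i j k h => neumannExt_apply h]
  have hAC : ip G (backX G (dx G (dz G u))) (dz G c) = ip G (dx G v) (dx G v) := by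
    rw [← neg_neg (ip G _ (dz G c)), ← ip_backZ _ _ hz.dx.backX, hA', hcv, ip_comm,
      ip_backX _ _ hxv, neg_neg]
  have hBC : ip G (backY G (dy G (dz G u))) (dz G c) = ip G (dy G v) (dy G v) := by
    rw [← neg_neg (ip G _ (dz G c)), ← ip_backZ _ _ hz.dy.backY, hB', hcv, ip_comm,
      ip_backY _ _ hyv, neg_neg]
  have hxz : VanishX G (dx G (dz G u)) := by
    have : dx G (dz G u) = dz G (dx G u) := by funext i j k; simp only [dx, dz]; ring
    rw [this]; exact hx.dz
  have hyz : VanishY G (dy G (dz G u)) := by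
    have : dy G (dz G u) = dz G (dy G u) := by funext i j k; simp only [dy, dz]; ring
    rw [this]; exact hy.dz
  have hAB := ip_xx_yy (dz G u) hxz hyz
  have hmix : dy G (dx G (dz G u)) = dz G (dy G (dx G u)) := by
    funext i j k; simp only [dx, dy, dz]; ring
  rw [hmix] at hAB
  have h1 := ip_self_nonneg hG (dx G (lap G u))
  have h2 := ip_self_nonneg hG (dy G (lap G u))
  rw [gradIp, ip_self_congr hcell]
  have n1 := ip_self_nonneg hG (backX G (dx G (dz G u)))
  have n2 := ip_self_nonneg hG (backY G (dy G (dz G u)))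
  have n3 := ip_self_nonneg hG (dz G c)
  have n4 := ip_self_nonneg hG (dx G v)
  have n5 := ip_self_nonneg hG (dy G v)
  simp only [ip_add_left, ip_add_right, ip_comm (backY G (dy G (dz G u))) (backX G _),
    ip_comm (dz G c) (backX G _), ip_comm (dz G c) (backY G _), hAB, hAC, hBC]
  linarith

/-! ### A discrete interpolation inequality for the maximum norm -/

theorem sq_le_sum_nat (K : ℕ) (f : ℕ → ℝ) {m : ℕ} (hm : m ≤ K) {t : ℝ} (ht : 0 < t) :
    f m ^ 2 ≤ (1 / (K + 1) + 1 / t) * ∑ n ∈ Finset.range (K + 1), f n ^ 2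
      + t * ∑ n ∈ Finset.range K, (f (n + 1) - f n) ^ 2 := by
  set S := ∑ n ∈ Finset.range (K + 1), f n ^ 2
  set D := ∑ n ∈ Finset.range K, (f (n + 1) - f n) ^ 2
  have hV : ∑ n ∈ Finset.range K, |f (n + 1) ^ 2 - f n ^ 2| ≤ t * D + 1 / t * S := by
    have h1 : ∀ n ∈ Finset.range K, |f (n + 1) ^ 2 - f n ^ 2|
        ≤ t * (f (n + 1) - f n) ^ 2 + 1 / (2 * t) * (f (n + 1) ^ 2 + f n ^ 2) := by
      intro n _
      have e : 0 ≤ 1 / (4 * t) * (2 * t * |f (n + 1) - f n| - |f (n + 1) + f n|) ^ 2 := by positivity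
      have e2 : 1 / (4 * t) * (2 * t * |f (n + 1) - f n| - |f (n + 1) + f n|) ^ 2
          = t * |f (n + 1) - f n| ^ 2 - |f (n + 1) - f n| * |f (n + 1) + f n|
            + 1 / (4 * t) * |f (n + 1) + f n| ^ 2 := by
        field_simp; ring
      have e3 : |f (n + 1) ^ 2 - f n ^ 2| = |f (n + 1) - f n| * |f (n + 1) + f n| := by
        rw [← abs_mul]; congr 1; ring
      have e4 : 1 / (2 * t) * (f (n + 1) ^ 2 + f n ^ 2) - 1 / (4 * t) * (f (n + 1) + f n) ^ 2
          = 1 / (4 * t) * (f (n + 1) - f n) ^ 2 := by field_simp; ring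
      have e5 : 0 ≤ 1 / (4 * t) * (f (n + 1) - f n) ^ 2 := by positivity
      rw [e2, sq_abs, sq_abs] at e
      linarith
    refine (Finset.sum_le_sum h1).trans ?_
    rw [Finset.sum_add_distrib, ← Finset.mul_sum, ← Finset.mul_sum, Finset.sum_add_distrib]
    have h2 : ∑ n ∈ Finset.range K, f (n + 1) ^ 2 ≤ S := by
      simp only [S]; rw [Finset.sum_range_succ' (fun n => f n ^ 2)]; nlinarith [sq_nonneg (f 0)]
    have h3 : ∑ n ∈ Finset.range K, f n ^ 2 ≤ S := by
      simp only [S]; rw [Finset.sum_range_succ (fun n => f n ^ 2)]; nlinarith [sq_nonneg (f K)]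
    have h4 : 1 / (2 * t) * (∑ n ∈ Finset.range K, f (n + 1) ^ 2 + ∑ n ∈ Finset.range K, f n ^ 2)
        ≤ 1 / (2 * t) * (S + S) := by gcongr
    have h5 : 1 / (2 * t) * (S + S) = 1 / t * S := by field_simp; ring
    linarith
  have hd : ∀ a b, a ≤ b → b ≤ K → |f a ^ 2 - f b ^ 2|
      ≤ ∑ n ∈ Finset.range K, |f (n + 1) ^ 2 - f n ^ 2| := by
    intro a b hab hb
    have := dist_le_Ico_sum_dist (fun n => f n ^ 2) hab
    simp only [Real.dist_eq] at this
    refine this.trans ?_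
    rw [Finset.sum_congr rfl fun n _ => abs_sub_comm (f n ^ 2) (f (n + 1) ^ 2)]
    refine Finset.sum_le_sum_of_subset_of_nonneg (fun n hn => ?_) fun _ _ _ => abs_nonneg _
    simp only [Finset.mem_Ico, Finset.mem_range] at hn ⊢; omega
  have hp : ∀ n ∈ Finset.range (K + 1), f m ^ 2 ≤ f n ^ 2 + (t * D + 1 / t * S) := by
    intro n hn
    have hn' : n ≤ K := by simpa [Nat.lt_succ_iff] using hn
    rcases le_total m n with h | h
    · have := (abs_le.1 (hd m n h hn')).2; linarith
    · have := (abs_le.1 (hd n m h hm)).1; linarith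
  have hs := Finset.sum_le_sum hp
  rw [Finset.sum_add_distrib, Finset.sum_const, Finset.sum_const, Finset.card_range,
    nsmul_eq_mul, nsmul_eq_mul] at hs
  push_cast at hs
  have hK : (0 : ℝ) < K + 1 := by positivity
  have : f m ^ 2 ≤ (S + (K + 1) * (t * D + 1 / t * S)) / (K + 1) := by
    rw [le_div_iff₀ hK]; linarith
  refine this.trans (le_of_eq ?_)
  field_simp; ring

theorem sum_Icc_int (N : ℕ) (f : ℤ → ℝ) :
    ∑ i ∈ Finset.Icc (1 : ℤ) N, f i = ∑ n ∈ Finset.range N, f (n + 1) := by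
  induction N with
  | zero => simp
  | succ n ih =>
    rw [Icc_one_succ, Finset.sum_insert (by simp), ih, Finset.sum_range_succ]
    push_cast; ring

/-- The one-dimensional inequality of Agmon, with a free parameter. -/
theorem sq_le_sum {N : ℕ} {h L : ℝ} (hh : 0 < h) (hL : N * h = L) (f : ℤ → ℝ) {m : ℤ}
    (hm : 1 ≤ m ∧ m ≤ N) {t : ℝ} (ht : 0 < t) :
    f m ^ 2 ≤ (1 / L + 1 / t) * (h * ∑ i ∈ Finset.Icc (1 : ℤ) N, f i ^ 2)
      + t * (h * ∑ i ∈ Finset.Icc (1 : ℤ) N, ((f (i + 1) - f i) / h) ^ 2) := by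
  obtain ⟨K, rfl⟩ : ∃ K : ℕ, N = K + 1 := ⟨N - 1, by omega⟩
  have h1 := sq_le_sum_nat K (fun n => f (n + 1)) (m := (m - 1).toNat) (by omega)
    (div_pos ht hh)
  have h2 : (((m - 1).toNat : ℤ)) + 1 = m := by omega
  simp only [h2] at h1
  rw [sum_Icc_int, sum_Icc_int]
  have h3 : ∑ n ∈ Finset.range K, (f (((n + 1 : ℕ) : ℤ) + 1) - f (n + 1)) ^ 2
      ≤ ∑ n ∈ Finset.range (K + 1), (f ((n : ℤ) + 1 + 1) - f (n + 1)) ^ 2 := by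
    rw [Finset.sum_range_succ]
    push_cast
    linarith [sq_nonneg (f ((K : ℤ) + 1 + 1) - f ((K : ℤ) + 1))]
  have hK : (0 : ℝ) < K + 1 := by positivity
  simp only [div_pow, ← Finset.sum_div]
  subst hL
  refine h1.trans ?_
  have h4 := mul_le_mul_of_nonneg_left h3 (div_pos ht hh).le
  refine (add_le_add_right h4 _).trans (le_of_eq ?_)
  push_cast
  field_simp

/-- The square of the discrete `L²` norm over the slice `k`. -/
noncomputable def slice (G : Grid) (k : ℤ) (v : CellFn) : ℝ :=
  G.h ^ 2 * ∑ i ∈ Finset.Icc (1 : ℤ) G.Nx, ∑ j ∈ Finset.Icc (1 : ℤ) G.Ny, v i j k ^ 2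

/-- The inequality of Agmon in the third direction, summed over a slice. -/
theorem slice_le (hG : G.Pos) {L : ℝ} (hL : G.Nz * G.h = L) {k : ℤ} (hk : 1 ≤ k ∧ k ≤ G.Nz)
    (v : CellFn) {t : ℝ} (ht : 0 < t) :
    slice G k v ≤ (1 / L + 1 / t) * ip G v v + t * ip G (dz G v) (dz G v) := by
  have e : ∀ w : CellFn, ip G w w = G.h ^ 2 * ∑ i ∈ Finset.Icc (1 : ℤ) G.Nx,
      ∑ j ∈ Finset.Icc (1 : ℤ) G.Ny, (G.h * ∑ k ∈ Finset.Icc (1 : ℤ) G.Nz, w i j k ^ 2) := by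
    intro w
    simp only [← Finset.mul_sum, ip, cellSum, Pi.mul_apply, ← sq]
    ring
  rw [e, e, slice, mul_left_comm _ (G.h ^ 2), mul_left_comm _ (G.h ^ 2), ← mul_add]
  refine mul_le_mul_of_nonneg_left ?_ (by positivity)
  rw [Finset.mul_sum, Finset.mul_sum, ← Finset.sum_add_distrib]
  refine Finset.sum_le_sum fun i _ => ?_
  rw [Finset.mul_sum, Finset.mul_sum, ← Finset.sum_add_distrib]
  exact Finset.sum_le_sum fun j _ => sq_le_sum hG.h hL (fun k => v i j k) hk ht

/-- The inequality of Agmon in the first two directions. -/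
theorem sq_le_slice (hG : G.Pos) {Lx Ly : ℝ} (hLx : 0 < Lx) (hx : G.Nx * G.h = Lx)
    (hy : G.Ny * G.h = Ly) {i j k : ℤ} (hi : 1 ≤ i ∧ i ≤ G.Nx) (hj : 1 ≤ j ∧ j ≤ G.Ny)
    (u : CellFn) {t : ℝ} (ht : 0 < t) :
    u i j k ^ 2 ≤ (1 / Lx + 1 / t) * ((1 / Ly + 1 / t) * slice G k u + t * slice G k (dy G u))
      + t * ((1 / Ly + 1 / t) * slice G k (dx G u) + t * slice G k (dy G (dx G u))) := by
  have key : ∀ v : CellFn, G.h * ∑ i ∈ Finset.Icc (1 : ℤ) G.Nx, v i j k ^ 2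
      ≤ (1 / Ly + 1 / t) * slice G k v + t * slice G k (dy G v) := by
    intro v
    have e : ∀ w : CellFn, slice G k w = G.h * ∑ i ∈ Finset.Icc (1 : ℤ) G.Nx,
        (G.h * ∑ j ∈ Finset.Icc (1 : ℤ) G.Ny, w i j k ^ 2) := by
      intro w
      simp only [← Finset.mul_sum, slice]
      ring
    rw [e, e, mul_left_comm _ G.h, mul_left_comm _ G.h, ← mul_add]
    refine mul_le_mul_of_nonneg_left ?_ hG.h.le
    rw [Finset.mul_sum, Finset.mul_sum, ← Finset.sum_add_distrib]
    exact Finset.sum_le_sum fun i _ => sq_le_sum hG.h hy (fun j => v i j k) hj ht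
  refine (sq_le_sum hG.h hx (fun i => u i j k) hi ht).trans ?_
  have h1 := key u
  have h2 : G.h * ∑ i ∈ Finset.Icc (1 : ℤ) G.Nx, ((u (i + 1) j k - u i j k) / G.h) ^ 2
      ≤ (1 / Ly + 1 / t) * slice G k (dx G u) + t * slice G k (dy G (dx G u)) := key (dx G u)
  gcongr

theorem Grid.Discretizes.mul_x {Lx Ly Lz : ℝ} (hG : G.Discretizes Lx Ly Lz) : G.Nx * G.h = Lx := by
  have := hG.Nx_pos; rw [hG.h_eq_x]; field_simp
theorem Grid.Discretizes.mul_y {Lx Ly Lz : ℝ} (hG : G.Discretizes Lx Ly Lz) : G.Ny * G.h = Ly := by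
  have := hG.Ny_pos; rw [hG.h_eq_y]; field_simp
theorem Grid.Discretizes.mul_z {Lx Ly Lz : ℝ} (hG : G.Discretizes Lx Ly Lz) : G.Nz * G.h = Lz := by
  have := hG.Nz_pos; rw [hG.h_eq_z]; field_simp

/-- The second and third differences in terms of `q ^ 4 = 1 + ‖∇_h Δ_h u‖`. For the second ones,
`‖Δ_h u‖² = -(∇_h u, ∇_h Δ_h u)`. -/
theorem mixed_le (hG : G.Pos) {B : ℝ} (hB : 0 ≤ B) {u : CellFn} (hu : IsExt G u)
    (h1 : gradIp G u u ≤ B) {Z : ℝ} (hX : √(gradIp G (lap G u) (lap G u)) + 1 = Z) :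
    ip G (dy G (dx G u)) (dy G (dx G u)) ≤ (B + 1) * Z ∧
    ip G (dz G (dx G u)) (dz G (dx G u)) ≤ (B + 1) * Z ∧
    ip G (dz G (dy G u)) (dz G (dy G u)) ≤ (B + 1) * Z ∧
    ip G (dz G (dy G (dx G u))) (dz G (dy G (dx G u))) ≤ Z ^ 2 := by
  set X := √(gradIp G (lap G u) (lap G u)) with hXdef
  have hX0 : 0 ≤ X := Real.sqrt_nonneg _
  have hXsq : gradIp G (lap G u) (lap G u) = X ^ 2 :=
    (Real.sq_sqrt (gradIp_self_nonneg hG _)).symm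
  have hZ : 0 < Z := by linarith
  have hm1 := ip_self_nonneg hG (dy G (dx G u))
  have hm2 := ip_self_nonneg hG (dz G (dx G u))
  have hm3 := ip_self_nonneg hG (dz G (dy G u))
  have hlap : ip G (lap G u) (lap G u) ≤ (B + 1) * Z := by
    have e := gradIp_le hG ((-1 : ℝ) • u) (lap G u) hZ
    simp only [gradIp_smul_left, gradIp_smul_right] at e
    rw [hXsq] at e
    have e3 : 1 / (2 * Z) * X ^ 2 ≤ 1 / (2 * Z) * Z ^ 2 := by
      gcongr; linarith
    have e4 : 1 / (2 * Z) * Z ^ 2 = Z / 2 := by field_simp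
    have e5 : Z / 2 * gradIp G u u ≤ Z / 2 * B := by gcongr
    rw [ip_lap hG hu]
    have e6 : 0 ≤ Z * B := by positivity
    linarith
  have hmix := mixed_le_lap hG hu
  have hthird := mixed_le_grad_lap hG hu
  have hXZ : X ^ 2 ≤ Z ^ 2 := by gcongr; linarith
  have hn := ip_self_nonneg hG (dz G (dy G (dx G u)))
  refine ⟨?_, ?_, ?_, ?_⟩ <;> linarith

/-- The choice `η / q` of the parameter in `sq_le_slice`. The powers of `q` are arranged so that the
mixed second difference, of order `q ^ 6` on a slice, contributes a small multiple of `q ^ 4`, and the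
function itself only `q ^ 2`. -/
theorem slices_combine {Lx Ly S₀ S₁ S₂ S₃ b₀ P b₃ q η : ℝ} (hLx : 0 < Lx) (hLy : 0 < Ly)
    (hS₀ : 0 ≤ S₀) (hS₁ : 0 ≤ S₁) (hS₂ : 0 ≤ S₂) (hq : 1 ≤ q) (hη : 0 < η) (hη1 : η ≤ 1)
    (h₀ : S₀ ≤ b₀) (h₁ : S₁ ≤ P) (h₂ : S₂ ≤ P) (h₃ : S₃ ≤ b₃ * q ^ 6) :
    (1 / Lx + 1 / (η / q)) * ((1 / Ly + 1 / (η / q)) * S₀ + η / q * S₂)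
      + η / q * ((1 / Ly + 1 / (η / q)) * S₁ + η / q * S₃)
      ≤ (1 / Lx + 1 / η) * (1 / Ly + 1 / η) * b₀ * q ^ 2 + (1 / Lx + 1 / Ly + 2) * P
        + η ^ 2 * b₃ * q ^ 4 := by
  have hq0 : 0 < q := by linarith
  have ax : ∀ L : ℝ, 0 < L → 1 / L + 1 / (η / q) ≤ (1 / L + 1 / η) * q := by
    intro L hL
    have : 1 / L ≤ 1 / L * q := le_mul_of_one_le_right (by positivity) hq
    have e : 1 / (η / q) = 1 / η * q := by field_simp
    rw [e]; linarith
  have at' : ∀ L : ℝ, 0 < L → (1 / L + 1 / (η / q)) * (η / q) ≤ 1 / L + 1 := by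
    intro L hL
    have e : (1 / L + 1 / (η / q)) * (η / q) = 1 / L * (η / q) + 1 := by field_simp
    have e2 : η / q ≤ 1 := (div_le_one hq0).2 (by linarith)
    have e3 : 1 / L * (η / q) ≤ 1 / L * 1 := by gcongr
    linarith
  have hP : 0 ≤ P := hS₁.trans h₁
  have ax1 := ax Lx hLx
  have ax2 := ax Ly hLy
  have at1 := at' Lx hLx
  have at2 := at' Ly hLy
  have t1 : (1 / Lx + 1 / (η / q)) * (1 / Ly + 1 / (η / q)) * S₀
      ≤ ((1 / Lx + 1 / η) * q) * ((1 / Ly + 1 / η) * q) * b₀ := by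
    gcongr
  have t2 : (1 / Lx + 1 / (η / q)) * (η / q) * S₂ ≤ (1 / Lx + 1) * P := by
    gcongr
  have t3 : (1 / Ly + 1 / (η / q)) * (η / q) * S₁ ≤ (1 / Ly + 1) * P := by
    gcongr
  have t4 : (η / q) ^ 2 * S₃ ≤ (η / q) ^ 2 * (b₃ * q ^ 6) := by gcongr
  have t5 : (η / q) ^ 2 * (b₃ * q ^ 6) = η ^ 2 * b₃ * q ^ 4 := by field_simp
  linarith

theorem slice_nonneg (k : ℤ) (v : CellFn) : 0 ≤ slice G k v :=
  mul_nonneg (sq_nonneg _) (Finset.sum_nonneg fun _ _ => Finset.sum_nonneg fun _ _ => sq_nonneg _)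

/-- The estimate behind `sup_bound`, before the parameters are chosen: `q ^ 4` stands for
`1 + ‖∇_h Δ_h u‖`. -/
theorem sq_le_of_lap {Lx Ly Lz B : ℝ} (hLx : 0 < Lx) (hLy : 0 < Ly) (hLz : 0 < Lz) (hB : 0 ≤ B)
    (hG : G.Discretizes Lx Ly Lz) {u : CellFn} (hu : IsExt G u) (h0 : ip G u u ≤ B)
    (h1 : gradIp G u u ≤ B) {q η ρ : ℝ} (hq : 1 ≤ q) (hη : 0 < η) (hη1 : η ≤ 1) (hρ : 0 < ρ)
    (hX : √(gradIp G (lap G u) (lap G u)) + 1 = q ^ 4) {i j k : ℤ} (hc : IsCell G i j k) :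
    u i j k ^ 2 ≤ (1 / Lx + 1 / η) * (1 / Ly + 1 / η) * ((1 / Lz + 2) * B) * q ^ 2
      + (1 / Lx + 1 / Ly + 2) * ((1 / Lz + 1 / ρ) * B + ρ * (B + 1) * q ^ 4)
      + η ^ 2 * ((1 / Lz + 1) * (B + 1) + 1) * q ^ 4 := by
  have hP := hG.pos hLx
  have hq0 : 0 < q := by linarith
  obtain ⟨m1, m2, m3, m4⟩ := mixed_le hP hB hu h1 hX
  have hd1 := ip_self_nonneg hP (dx G u)
  have hd2 := ip_self_nonneg hP (dy G u)
  have hd3 := ip_self_nonneg hP (dz G u)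
  have hg : gradIp G u u = ip G (dx G u) (dx G u) + ip G (dy G u) (dy G u)
    + ip G (dz G u) (dz G u) := rfl
  have hm := ip_self_nonneg hP (dy G (dx G u))
  have hk := hc.2.2
  have s0 : slice G k u ≤ (1 / Lz + 2) * B := by
    have := slice_le hP hG.mul_z hk u one_pos
    have e : (1 / Lz + 1 / 1) * ip G u u ≤ (1 / Lz + 1 / 1) * B := by gcongr
    linarith
  have s1 : slice G k (dx G u) ≤ (1 / Lz + 1 / ρ) * B + ρ * ((B + 1) * q ^ 4) := by
    refine (slice_le hP hG.mul_z hk _ hρ).trans ?_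
    gcongr; linarith
  have s2 : slice G k (dy G u) ≤ (1 / Lz + 1 / ρ) * B + ρ * ((B + 1) * q ^ 4) := by
    refine (slice_le hP hG.mul_z hk _ hρ).trans ?_
    gcongr; linarith
  -- between the second difference, of order `q ^ 4`, and the third one, of order `q ^ 8`
  have s3 : slice G k (dy G (dx G u)) ≤ ((1 / Lz + 1) * (B + 1) + 1) * q ^ 6 := by
    have e1 := slice_le hP hG.mul_z hk (dy G (dx G u)) (t := 1 / q ^ 2) (by positivity)
    have e2 : (1 / Lz + 1 / (1 / q ^ 2)) * ip G (dy G (dx G u)) (dy G (dx G u))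
        ≤ (1 / Lz * q ^ 2 + q ^ 2) * ((B + 1) * q ^ 4) := by
      have : 1 / Lz ≤ 1 / Lz * q ^ 2 := le_mul_of_one_le_right (by positivity) (one_le_pow₀ hq)
      rw [one_div_one_div]
      gcongr
    have e3 : 1 / q ^ 2 * ip G (dz G (dy G (dx G u))) (dz G (dy G (dx G u)))
        ≤ 1 / q ^ 2 * (q ^ 4) ^ 2 := by gcongr
    have e4 : 1 / q ^ 2 * (q ^ 4) ^ 2 = q ^ 6 := by field_simp
    linarith
  have hmain := sq_le_slice hP hLx hG.mul_x hG.mul_y hc.1 hc.2.1 (k := k) u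
    (t := η / q) (by positivity)
  have hcomb := slices_combine hLx hLy (slice_nonneg k u) (slice_nonneg k (dx G u))
    (slice_nonneg k (dy G u)) hq hη hη1 s0 s1 s2 s3
  linarith

/-- Functions bounded in the discrete `H¹` norm: the square of the maximum norm grows at most like
an arbitrarily small multiple of `‖∇_h Δ_h u‖`. -/
theorem sup_bound {Lx Ly Lz B κ : ℝ} (hLx : 0 < Lx) (hLy : 0 < Ly) (hLz : 0 < Lz) (hB : 0 ≤ B)
    (hκ : 0 < κ) : ∃ C : ℝ, 0 ≤ C ∧ ∀ (G : Grid) (u : CellFn), G.Discretizes Lx Ly Lz → IsExt G u →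
      ip G u u ≤ B → gradIp G u u ≤ B → ∀ i j k, IsCell G i j k →
        u i j k ^ 2 ≤ C + κ * √(gradIp G (lap G u) (lap G u)) := by
  -- each of `η`, `ρ`, `τ` makes one term of `sq_le_of_lap` at most `κ / 3 * q ^ 4`
  set c₂ := (1 / Lz + 1) * (B + 1) + 1 with hc₂
  have hc₂0 : 0 < c₂ := by positivity
  set l := 1 / Lx + 1 / Ly + 2 with hl
  have hl0 : 0 < l := by positivity
  set η := min 1 (κ / (3 * c₂)) with hη
  have hη0 : 0 < η := lt_min one_pos (by positivity)
  have hη1 : η ≤ 1 := min_le_left _ _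
  have hη2 : η ≤ κ / (3 * c₂) := min_le_right _ _
  set ρ := κ / (3 * (l * (B + 1))) with hρ
  have hρ0 : 0 < ρ := by positivity
  set c₁ := (1 / Lx + 1 / η) * (1 / Ly + 1 / η) * ((1 / Lz + 2) * B) with hc₁
  have hc₁0 : 0 ≤ c₁ := by positivity
  set τ := κ / (3 * (c₁ + 1)) with hτ
  have hτ0 : 0 < τ := by positivity
  refine ⟨c₁ * (1 / τ) + l * ((1 / Lz + 1 / ρ) * B) + κ, by positivity, ?_⟩
  intro G u hG hu h0 h1 i j k hc
  set X := √(gradIp G (lap G u) (lap G u)) with hX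
  have hX0 : 0 ≤ X := Real.sqrt_nonneg _
  have hq4 : X + 1 = √(√(X + 1)) ^ 4 := by
    rw [show (4 : ℕ) = 2 * 2 from rfl, pow_mul, Real.sq_sqrt (Real.sqrt_nonneg _),
      Real.sq_sqrt (by linarith)]
  have hq1 : 1 ≤ √(√(X + 1)) := by
    rw [Real.one_le_sqrt, Real.one_le_sqrt]; linarith
  set q := √(√(X + 1)) with hq
  have h := sq_le_of_lap hLx hLy hLz hB hG hu h0 h1 hq1 hη0 hη1 hρ0 hq4 hc
  have e1 : η ^ 2 * c₂ * q ^ 4 ≤ κ / 3 * q ^ 4 := by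
    have : η ^ 2 * c₂ ≤ κ / 3 := by
      calc η ^ 2 * c₂ ≤ η * c₂ := by gcongr; nlinarith
        _ ≤ κ / (3 * c₂) * c₂ := by gcongr
        _ = κ / 3 := by field_simp
    gcongr
  have e2 : l * (ρ * (B + 1) * q ^ 4) = κ / 3 * q ^ 4 := by rw [hρ]; field_simp
  have e3 : c₁ * q ^ 2 ≤ κ / 3 * q ^ 4 + c₁ * (1 / τ) := by
    have f1 : q ^ 2 ≤ τ * q ^ 4 + 1 / τ := by
      have f : 0 ≤ τ * (q ^ 2 - 1 / (2 * τ)) ^ 2 := by positivity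
      have f' : τ * (q ^ 2 - 1 / (2 * τ)) ^ 2 = τ * q ^ 4 - q ^ 2 + 1 / 4 * (1 / τ) := by
        field_simp; ring
      have : 0 < 1 / τ := by positivity
      linarith
    have f2 : c₁ * τ ≤ κ / 3 := by
      rw [hτ, ← mul_div_assoc, div_le_div_iff₀ (by positivity) (by norm_num)]
      nlinarith
    have f3 := mul_le_mul_of_nonneg_left f1 hc₁0
    have f4 : c₁ * τ * q ^ 4 ≤ κ / 3 * q ^ 4 := by gcongr
    linarith
  rw [← hq4] at e1 e2 e3 h
  linarith

/-! ### The third-order estimate for one time step -/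

theorem ip_self_le_of_sq_le (hG : G.Pos) {f g w : CellFn} {K : ℝ}
    (h : ∀ i j k, f i j k ^ 2 ≤ K * (g i j k ^ 2 + w i j k ^ 2)) :
    ip G f f ≤ K * (ip G g g + ip G w w) := by
  have e : K * (ip G g g + ip G w w) = G.h ^ 3 * cellSum G (K • (g * g + w * w)) := by
    rw [cellSum_smul, cellSum_add, ip, ip]; ring
  rw [e, ip]
  refine mul_le_mul_of_nonneg_left (cellSum_mono fun i j k _ => ?_) (pow_nonneg hG.h.le 3)
  have := h i j k
  simpa [sq] using this

theorem sq_chi_sub_le {a a' b b' U : ℝ} (ha : a ^ 2 ≤ U) (ha' : a' ^ 2 ≤ U) (hb : b ^ 2 ≤ U)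
    (hb' : b' ^ 2 ≤ U) :
    ((1 / 4) * (a' ^ 2 + b' ^ 2) * (a' + b') - (1 / 4) * (a ^ 2 + b ^ 2) * (a + b)) ^ 2
      ≤ 8 * U ^ 2 * ((a' - a) ^ 2 + (b' - b) ^ 2) := by
  have key : ∀ x y z : ℝ, x ^ 2 ≤ U → y ^ 2 ≤ U → z ^ 2 ≤ U →
      (1 / 4 * (x ^ 2 + x * y + y ^ 2 + (x + y) * z + z ^ 2)) ^ 2 ≤ (2 * U) ^ 2 := by
    intro x y z hx hy hz
    apply sq_le_sq'
    · nlinarith [sq_nonneg (x + y), sq_nonneg (x + z), sq_nonneg (y + z)]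
    · nlinarith [sq_nonneg (x - y), sq_nonneg (x - z), sq_nonneg (y - z)]
  have h1 := key a' a b' ha' ha hb'
  have h2 := key b' b a hb' hb ha
  set p := 1 / 4 * (a' ^ 2 + a' * a + a ^ 2 + (a' + a) * b' + b' ^ 2) with hp
  set q := 1 / 4 * (b' ^ 2 + b' * b + b ^ 2 + (b' + b) * a + a ^ 2) with hq
  have e : (1 / 4) * (a' ^ 2 + b' ^ 2) * (a' + b') - (1 / 4) * (a ^ 2 + b ^ 2) * (a + b)
      = (a' - a) * p + (b' - b) * q := by rw [hp, hq]; ring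
  rw [e]
  have h3 := mul_le_mul_of_nonneg_left h1 (sq_nonneg (a' - a))
  have h4 := mul_le_mul_of_nonneg_left h2 (sq_nonneg (b' - b))
  have h5 := sq_nonneg ((a' - a) * p - (b' - b) * q)
  linarith

theorem gradIp_chi_le (hG : G.Pos) {b c : CellFn} {U : ℝ} (hb : ∀ i j k, b i j k ^ 2 ≤ U)
    (hc : ∀ i j k, c i j k ^ 2 ≤ U) :
    gradIp G (chi c b) (chi c b) ≤ 8 * U ^ 2 * (gradIp G c c + gradIp G b b) := by
  have key : ∀ {x x' y y' : ℝ}, x ^ 2 ≤ U → x' ^ 2 ≤ U → y ^ 2 ≤ U → y' ^ 2 ≤ U →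
      (((1 / 4) * (x' ^ 2 + y' ^ 2) * (x' + y') - (1 / 4) * (x ^ 2 + y ^ 2) * (x + y)) / G.h) ^ 2
        ≤ 8 * U ^ 2 * (((x' - x) / G.h) ^ 2 + ((y' - y) / G.h) ^ 2) := by
    intro x x' y y' h1 h2 h3 h4
    rw [div_pow, div_pow, div_pow, ← add_div, ← mul_div_assoc]
    gcongr
    exact sq_chi_sub_le h1 h2 h3 h4
  have h1 := ip_self_le_of_sq_le hG (f := dx G (chi c b)) (g := dx G c) (w := dx G b)
    fun i j k => key (hc _ _ _) (hc _ _ _) (hb _ _ _) (hb _ _ _)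
  have h2 := ip_self_le_of_sq_le hG (f := dy G (chi c b)) (g := dy G c) (w := dy G b)
    fun i j k => key (hc _ _ _) (hc _ _ _) (hb _ _ _) (hb _ _ _)
  have h3 := ip_self_le_of_sq_le hG (f := dz G (chi c b)) (g := dz G c) (w := dz G b)
    fun i j k => key (hc _ _ _) (hc _ _ _) (hb _ _ _) (hb _ _ _)
  simp only [gradIp]
  linarith

theorem gradIp_sub_self_le (hG : G.Pos) (u v w : CellFn) :
    gradIp G (u - v - w) (u - v - w) ≤ 3 * (gradIp G u u + gradIp G v v + gradIp G w w) := by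
  have h1 := gradIp_self_nonneg hG (u + v)
  have h2 := gradIp_self_nonneg hG (u + w)
  have h3 := gradIp_self_nonneg hG (v - w)
  simp only [gradIp_sub_left, gradIp_sub_right, gradIp_add_left, gradIp_add_right,
    gradIp_comm v u, gradIp_comm w u, gradIp_comm w v] at h1 h2 h3 ⊢
  linarith

theorem IsExt.forall_of_cell {u : CellFn} (hG : G.Pos) (hu : IsExt G u) {P : ℝ → Prop}
    (h : ∀ i j k, IsCell G i j k → P (u i j k)) (i j k : ℤ) : P (u i j k) := by
  rw [← hu]; exact h _ _ _ (isCell_clamp hG i j k)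

/-- The value of the parameter of `sup_bound` with which the third-order part of the nonlinearity is
at most `ε⁴ / 32` times the third-order norms. -/
theorem smallness_le {B ε κ : ℝ} (hB : 0 ≤ B) (hκ : κ = ε ^ 2 / (72 * (B + 1))) :
    144 * B * κ ^ 2 ≤ ε ^ 4 / 32 := by
  have e : 144 * B * κ ^ 2 = ε ^ 4 / 36 * (B / (B + 1) ^ 2) := by
    rw [hκ]; field_simp; ring
  have e1 : B / (B + 1) ^ 2 ≤ 1 := by
    rw [div_le_one (by positivity)]; nlinarith
  have e2 : ε ^ 4 / 36 * (B / (B + 1) ^ 2) ≤ ε ^ 4 / 36 * 1 := by gcongr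
  have : 0 ≤ ε ^ 4 := by positivity
  rw [e]; linarith

theorem gradIp_extrap_le (hG : G.Pos) (a b : CellFn) :
    gradIp G (extrap a b) (extrap a b) ≤ 9 / 2 * gradIp G b b + 1 / 2 * gradIp G a a := by
  have h1 := gradIp_self_nonneg hG ((3 / 2 : ℝ) • b + (1 / 2 : ℝ) • a)
  rw [extrap_eq]
  simp only [gradIp_sub_left, gradIp_sub_right, gradIp_add_left, gradIp_add_right,
    gradIp_smul_left, gradIp_smul_right, gradIp_comm b a] at h1 ⊢
  linarith

theorem gradIp_weighted_ge (hG : G.Pos) (u v : CellFn) :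
    3 / 8 * gradIp G u u - 1 / 8 * gradIp G v v
      ≤ gradIp G ((3 / 4 : ℝ) • u + (1 / 4 : ℝ) • v) ((3 / 4 : ℝ) • u + (1 / 4 : ℝ) • v) := by
  have h := gradIp_self_nonneg hG (u + v)
  simp only [gradIp_add_left, gradIp_add_right, gradIp_smul_left, gradIp_smul_right,
    gradIp_comm v u] at h ⊢
  linarith

/-- The gradient of the nonlinearity, with the maximum norm bounded as in `sup_bound`. -/
theorem gradIp_chi_le_of_sup (hP : G.Pos) {b c : CellFn} {B C κ : ℝ} (hC : 0 ≤ C) (hκ : 0 ≤ κ)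
    (hb : IsExt G b) (hc : IsExt G c) (hb1 : gradIp G b b ≤ B) (hc1 : gradIp G c c ≤ B)
    (hsb : ∀ i j k, IsCell G i j k → b i j k ^ 2 ≤ C + κ * √(gradIp G (lap G b) (lap G b)))
    (hsc : ∀ i j k, IsCell G i j k → c i j k ^ 2 ≤ C + κ * √(gradIp G (lap G c) (lap G c))) :
    gradIp G (chi c b) (chi c b) ≤ 48 * B * (4 * C ^ 2
      + κ ^ 2 * (gradIp G (lap G c) (lap G c) + gradIp G (lap G b) (lap G b))) := by
  have hyb0 := gradIp_self_nonneg hP (lap G b)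
  have hyc0 := gradIp_self_nonneg hP (lap G c)
  have hXb := Real.sq_sqrt hyb0
  have hXc := Real.sq_sqrt hyc0
  have hXb0 := Real.sqrt_nonneg (gradIp G (lap G b) (lap G b))
  have hXc0 := Real.sqrt_nonneg (gradIp G (lap G c) (lap G c))
  set Xb := √(gradIp G (lap G b) (lap G b))
  set Xc := √(gradIp G (lap G c) (lap G c))
  set U := 2 * C + κ * Xc + κ * Xb with hU
  have hκb : 0 ≤ κ * Xb := by positivity
  have hκc : 0 ≤ κ * Xc := by positivity
  have hχ := gradIp_chi_le hP (U := U)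
    (hb.forall_of_cell hP (P := fun x => x ^ 2 ≤ U) fun i j k h => by
      have := hsb i j k h; linarith)
    (hc.forall_of_cell hP (P := fun x => x ^ 2 ≤ U) fun i j k h => by
      have := hsc i j k h; linarith)
  have hU2 : U ^ 2 ≤ 3 * (4 * C ^ 2 + κ ^ 2 * (Xc ^ 2 + Xb ^ 2)) := by
    rw [hU]
    linarith [sq_nonneg (2 * C - κ * Xc), sq_nonneg (2 * C - κ * Xb), sq_nonneg (κ * Xc - κ * Xb)]
  have hB : 0 ≤ B := (gradIp_self_nonneg hP b).trans hb1
  rw [← hXb, ← hXc]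
  calc _ ≤ 8 * U ^ 2 * (gradIp G c c + gradIp G b b) := hχ
    _ ≤ 8 * (3 * (4 * C ^ 2 + κ ^ 2 * (Xc ^ 2 + Xb ^ 2))) * (B + B) := by
      have := gradIp_self_nonneg hP c
      have := gradIp_self_nonneg hP b
      gcongr
    _ = _ := by ring

/-- The estimate of `∇_h Δ_h φ` at the new time level through the equation for the chemical
potential. The nonlinearity is bounded with `sup_bound`, whose small parameter is chosen so that
the resulting third-order terms can be absorbed after summation in time. -/
theorem third_order_step {Lx Ly Lz ε B : ℝ} (hLx : 0 < Lx) (hLy : 0 < Ly) (hLz : 0 < Lz)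
    (hε : 0 < ε) (hB : 0 ≤ B) : ∃ D : ℝ, 0 ≤ D ∧ ∀ (G : Grid) (a b c μ : CellFn),
      G.Discretizes Lx Ly Lz → IsExt G a → IsExt G b → IsExt G c →
      gradIp G a a ≤ B → ip G b b ≤ B → gradIp G b b ≤ B → ip G c c ≤ B → gradIp G c c ≤ B →
      μ = chi c b - extrap a b - ε ^ 2 • lap G ((3 / 4 : ℝ) • c + (1 / 4 : ℝ) • a) →
      ε ^ 4 * (3 / 8 * gradIp G (lap G c) (lap G c) - 1 / 8 * gradIp G (lap G a) (lap G a))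
        ≤ 3 * gradIp G μ μ + D
          + ε ^ 4 / 32 * (gradIp G (lap G c) (lap G c) + gradIp G (lap G b) (lap G b)) := by
  set κ := ε ^ 2 / (72 * (B + 1)) with hκdef
  have hκ : 0 < κ := by positivity
  obtain ⟨C, hC, hsup⟩ := sup_bound hLx hLy hLz hB hκ
  refine ⟨3 * (48 * B * (4 * C ^ 2)) + 15 * B, by positivity, ?_⟩
  intro G a b c μ hG ha hb hc ha1 hb0 hb1 hc0 hc1 hμ
  have hP := hG.pos hLx
  have hχ2 := gradIp_chi_le_of_sup hP hC hκ.le hb hc hb1 hc1 (hsup G b hG hb hb0 hb1)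
    (hsup G c hG hc hc0 hc1)
  have hκ2 : 144 * B * κ ^ 2 ≤ ε ^ 4 / 32 := smallness_le hB hκdef
  have hext := gradIp_extrap_le hP a b
  have hμ' : ε ^ 2 • lap G ((3 / 4 : ℝ) • c + (1 / 4 : ℝ) • a) = chi c b - extrap a b - μ := by
    rw [hμ]; abel
  have h3 := gradIp_sub_self_le hP (chi c b) (extrap a b) μ
  rw [← hμ', gradIp_smul_left, gradIp_smul_right, lap_add, lap_smul, lap_smul] at h3
  have h5 := mul_le_mul_of_nonneg_left (gradIp_weighted_ge hP (lap G c) (lap G a))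
    (show 0 ≤ ε ^ 4 by positivity)
  have h6 := mul_le_mul_of_nonneg_right hκ2
    (add_nonneg (gradIp_self_nonneg hP (lap G c)) (gradIp_self_nonneg hP (lap G b)))
  linarith

/-! ### Summation in time -/

/-- Summation of the one-step inequalities, where `F` is the modified energy and `y` the square of the
third-order norm. -/
theorem sum_le_of_step {y F : ℕ → ℝ} {s e D : ℝ} {M : ℕ} (hy : ∀ m, 0 ≤ y m) (hs : 0 ≤ s)
    (he : 0 ≤ e) (hD : 0 ≤ D)
    (h : ∀ m, 1 ≤ m → m + 1 ≤ M → s * (e * (3 / 8 * y (m + 1) - 1 / 8 * y (m - 1)))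
      ≤ 3 * (F m - F (m + 1)) + s * D + s * (e / 32 * (y (m + 1) + y m)))
    {ℓ : ℕ} (h1 : 1 ≤ ℓ) (hℓ : ℓ ≤ M) :
    1 / 16 * e * s * ∑ m ∈ Finset.Icc 1 ℓ, y m
      ≤ 3 * (F 1 - F ℓ) + s * ℓ * D + s * e * (y 0 + y 1) := by
  have hse : 0 ≤ s * e := mul_nonneg hs he
  -- the last two levels carry the terms that the next step consumes
  have key : s * e * (3 / 16 * ∑ m ∈ Finset.Icc 1 ℓ, y m + 5 / 32 * y ℓ + 1 / 8 * y (ℓ - 1))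
      ≤ 3 * (F 1 - F ℓ) + s * ℓ * D + s * e * (y 0 + y 1) := by
    induction ℓ, h1 using Nat.le_induction with
    | base =>
      have a0 := mul_nonneg hse (hy 0)
      have a1 := mul_nonneg hse (hy 1)
      have a2 := mul_nonneg hs hD
      simp only [Finset.Icc_self, Finset.sum_singleton, Nat.cast_one, Nat.sub_self]
      linarith
    | succ n hn ih =>
      have i1 := ih (by omega)
      have i2 := h n hn hℓ
      rw [Finset.sum_Icc_succ_top (by omega), Nat.add_sub_cancel]
      push_cast
      linarith
  have a1 := mul_nonneg hse (hy ℓ)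
  have a2 := mul_nonneg hse (hy (ℓ - 1))
  have a3 := mul_nonneg hse (Finset.sum_nonneg fun m (_ : m ∈ Finset.Icc 1 ℓ) => hy m)
  linarith

theorem Grid.Discretizes.volume {Lx Ly Lz : ℝ} (hG : G.Discretizes Lx Ly Lz) :
    G.h ^ 3 * (G.Nx * G.Ny * G.Nz) = Lx * Ly * Lz := by
  conv_rhs => rw [← hG.mul_x, ← hG.mul_y, ← hG.mul_z]
  ring

/-- A bound on the modified energy bounds the discrete `H¹` norms of both arguments. -/
theorem h1_le_of_modEnergy {Lx Ly Lz ε E : ℝ} (hLx : 0 < Lx) (hε : 0 < ε)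
    (hG : G.Discretizes Lx Ly Lz) {u v : CellFn} (hu : IsExt G u) (hv : IsExt G v)
    (h : modEnergy G ε u v + Lx * Ly * Lz ≤ E) :
    (ip G u u ≤ 20 * E * (1 + 1 / ε ^ 2) ∧ gradIp G u u ≤ 20 * E * (1 + 1 / ε ^ 2)) ∧
    (ip G v v ≤ 20 * E * (1 + 1 / ε ^ 2) ∧ gradIp G v v ≤ 20 * E * (1 + 1 / ε ^ 2)) := by
  have hP := hG.pos hLx
  have h0 := modEnergy_ge hP ε hu hv
  rw [hG.volume] at h0
  have n1 := ip_self_nonneg hP u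
  have n2 := gradIp_self_nonneg hP u
  have n3 := ip_self_nonneg hP (u - v)
  have n4 := gradIp_self_nonneg hP (u - v)
  have e2 : 0 < ε ^ 2 := by positivity
  have m2 := mul_nonneg e2.le n2
  have m4 := mul_nonneg e2.le n4
  have hE : 0 ≤ E := by linarith
  have hE2 : 0 ≤ E / ε ^ 2 := by positivity
  have b2 : gradIp G u u ≤ 2 * (E / ε ^ 2) := by
    rw [← mul_div_assoc, le_div_iff₀ e2]; linarith
  have b4 : gradIp G (u - v) (u - v) ≤ 8 * (E / ε ^ 2) := by
    rw [← mul_div_assoc, le_div_iff₀ e2]; linarith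
  have b3 : ip G (u - v) (u - v) ≤ 4 * E := by linarith
  have k1 := ip_self_nonneg hP ((2 : ℝ) • u - v)
  have k2 := gradIp_self_nonneg hP ((2 : ℝ) • u - v)
  have e : 20 * E * (1 + 1 / ε ^ 2) = 20 * E + 20 * (E / ε ^ 2) := by ring
  rw [e]
  simp only [ip_sub_left, ip_sub_right, gradIp_sub_left, gradIp_sub_right, ip_smul_left,
    ip_smul_right, gradIp_smul_left, gradIp_smul_right, ip_comm v u, gradIp_comm v u]
    at k1 k2 b3 b4
  refine ⟨⟨?_, ?_⟩, ?_, ?_⟩ <;> linarith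

/-- The estimate for solutions whose members are extended by the boundary conditions. The third
differences of the starting values enter explicitly. -/
theorem third_order_bound_of_isExt {Lx Ly Lz ε : ℝ} (hLx : 0 < Lx) (hLy : 0 < Ly) (hLz : 0 < Lz)
    (hε : 0 < ε) (C₀ : ℝ) : ∃ C₁₁ C₁₀ : ℝ, ∀ (G : Grid) (γ T s : ℝ) (M : ℕ) (φ : ℕ → CellFn),
      G.Discretizes Lx Ly Lz → 0 < γ → 0 < T → 0 < M → s = T / M →
      (∀ m, IsExt G (φ m)) →
      (∀ m : ℕ, 1 ≤ m → m + 1 ≤ M → ∃ μ p : CellFn, IsExt G μ ∧ IsExt G p ∧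
        IsStep G ε γ s (φ (m - 1)) (φ m) (φ (m + 1)) μ p) →
      modEnergy G ε (φ 1) (φ 0) ≤ C₀ →
      ∀ ℓ : ℕ, 1 ≤ ℓ → ℓ + 1 ≤ M →
        1 / 16 * ε ^ 4 * s * ∑ m ∈ Finset.Icc 1 ℓ, gradIp G (lap G (φ m)) (lap G (φ m))
          ≤ C₁₁ + C₁₀ * T + s * ε ^ 4 * (gradIp G (lap G (φ 0)) (lap G (φ 0))
            + gradIp G (lap G (φ 1)) (lap G (φ 1))) := by
  set V := Lx * Ly * Lz with hV
  have hV0 : 0 < V := by positivity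
  set E := |C₀| + V with hE
  have hE0 : 0 ≤ E := by positivity
  have hC₀ := le_abs_self C₀
  set B := 20 * E * (1 + 1 / ε ^ 2) with hBdef
  have hB : 0 ≤ B := by positivity
  obtain ⟨D, hD, hstep⟩ := third_order_step hLx hLy hLz hε hB
  refine ⟨3 * (C₀ + V), D, ?_⟩
  intro G γ T s M φ hG hγ hT hM hs hext hsol hF ℓ h1 hℓ
  have hP := hG.pos hLx
  have hM0 : (0 : ℝ) < M := by exact_mod_cast hM
  have hs0 : 0 ≤ s := by rw [hs]; positivity
  have hen : ∀ m, 1 ≤ m → m ≤ M → modEnergy G ε (φ m) (φ (m - 1)) ≤ C₀ := by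
    intro m hm
    induction m, hm using Nat.le_induction with
    | base => intro _; exact hF
    | succ n hn ih =>
      intro hnM
      obtain ⟨μ, p, hμ, hp, hst⟩ := hsol n hn hnM
      have := hst.energy_le hP hγ hs0 (hext _) (hext _) (hext _) hμ hp
      have h2 := mul_nonneg hs0 (gradIp_self_nonneg hP μ)
      have h3 := ih (by omega)
      rw [Nat.add_sub_cancel]
      linarith
  have hH1 : ∀ m, m ≤ M → ip G (φ m) (φ m) ≤ B ∧ gradIp G (φ m) (φ m) ≤ B := by
    intro m hm
    rcases Nat.eq_zero_or_pos m with rfl | hm1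
    · exact (h1_le_of_modEnergy hLx hε hG (hext 1) (hext 0) (E := E) (by linarith)).2
    · refine (h1_le_of_modEnergy hLx hε hG (hext m) (hext (m - 1)) (E := E) ?_).1
      have := hen m hm1 hm
      linarith
  have hsum := sum_le_of_step (y := fun m => gradIp G (lap G (φ m)) (lap G (φ m)))
    (F := fun m => modEnergy G ε (φ m) (φ (m - 1))) (s := s) (e := ε ^ 4) (D := D) (M := M)
    (fun m => gradIp_self_nonneg hP _) hs0 (by positivity) hD (fun m hm hmM => by
      obtain ⟨μ, p, hμ, hp, hst⟩ := hsol m hm hmM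
      have h2 := hst.energy_le hP hγ hs0 (hext _) (hext _) (hext _) hμ hp
      have h3 := hstep G (φ (m - 1)) (φ m) (φ (m + 1)) μ hG (hext _) (hext _) (hext _)
        (hH1 _ (by omega)).2 (hH1 _ (by omega)).1 (hH1 _ (by omega)).2 (hH1 _ hmM).1 (hH1 _ hmM).2
        (hst.mu_eq hP (hext _) (hext _) (hext _) hμ)
      have h4 := mul_le_mul_of_nonneg_left h3 hs0
      simp only [Nat.add_sub_cancel]
      linarith) h1 (by omega : ℓ ≤ M)
  have hlow := modEnergy_ge hP ε (hext ℓ) (hext (ℓ - 1))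
  rw [hG.volume] at hlow
  have n1 := ip_self_nonneg hP (φ ℓ)
  have n2 := mul_nonneg (sq_nonneg ε) (gradIp_self_nonneg hP (φ ℓ))
  have n3 := ip_self_nonneg hP (φ ℓ - φ (ℓ - 1))
  have n4 := mul_nonneg (sq_nonneg ε) (gradIp_self_nonneg hP (φ ℓ - φ (ℓ - 1)))
  have hsℓ : s * ℓ ≤ T := by
    have : (ℓ : ℝ) ≤ M := by exact_mod_cast (by omega : ℓ ≤ M)
    calc s * ℓ ≤ s * M := by gcongr
      _ = T := by rw [hs]; field_simp
  have hsD : s * ℓ * D ≤ T * D := by gcongr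
  simp only [Nat.sub_self] at hsum
  linarith

/-! ### Replacing solutions by their extensions -/

/-- The extension of a function with homogeneous Neumann boundary conditions agrees with it at the
cells and at the neighbours of the cells. -/
theorem Neumann.stencil (hG : G.Pos) {u : CellFn} (hu : Neumann G u) {i j k : ℤ}
    (h : IsCell G i j k) :
    neumannExt G u i j k = u i j k ∧ neumannExt G u (i + 1) j k = u (i + 1) j k ∧
    neumannExt G u (i - 1) j k = u (i - 1) j k ∧ neumannExt G u i (j + 1) k = u i (j + 1) k ∧
    neumannExt G u i (j - 1) k = u i (j - 1) k ∧ neumannExt G u i j (k + 1) = u i j (k + 1) ∧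
    neumannExt G u i j (k - 1) = u i j (k - 1) := by
  have hx := hG.x
  have hy := hG.y
  have hz := hG.z
  refine ⟨neumannExt_apply h, ?_⟩
  obtain ⟨⟨i1, i2⟩, ⟨j1, j2⟩, ⟨k1, k2⟩⟩ := h
  have ci := clamp_eq ⟨i1, i2⟩
  have cj := clamp_eq ⟨j1, j2⟩
  have ck := clamp_eq ⟨k1, k2⟩
  obtain ⟨x0, xN⟩ := hu.x_bdry j k j1 j2 k1 k2
  obtain ⟨y0, yN⟩ := hu.y_bdry i k i1 i2 k1 k2
  obtain ⟨z0, zN⟩ := hu.z_bdry i j i1 i2 j1 j2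
  simp only [neumannExt, ci, cj, ck]
  refine ⟨?_, ?_, ?_, ?_, ?_, ?_⟩
  · rcases lt_or_eq_of_le i2 with h | h
    · congr 1; omega
    · rw [h, ← xN]; congr 1; omega
  · rcases lt_or_eq_of_le i1 with h | h
    · congr 1; omega
    · rw [← h, sub_self, x0]; congr 1
  · rcases lt_or_eq_of_le j2 with h | h
    · congr 1; omega
    · rw [h, ← yN]; congr 1; omega
  · rcases lt_or_eq_of_le j1 with h | h
    · congr 1; omega
    · rw [← h, sub_self, y0]; congr 1
  · rcases lt_or_eq_of_le k2 with h | h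
    · congr 1; omega
    · rw [h, ← zN]; congr 1; omega
  · rcases lt_or_eq_of_le k1 with h | h
    · congr 1; omega
    · rw [← h, sub_self, z0]; congr 1

theorem Neumann.sub {u v : CellFn} (hu : Neumann G u) (hv : Neumann G v) : Neumann G (u - v) where
  x_bdry j k a b c d := by
    simp [(hu.x_bdry j k a b c d).1, (hu.x_bdry j k a b c d).2, (hv.x_bdry j k a b c d).1,
      (hv.x_bdry j k a b c d).2]
  y_bdry j k a b c d := by
    simp [(hu.y_bdry j k a b c d).1, (hu.y_bdry j k a b c d).2, (hv.y_bdry j k a b c d).1,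
      (hv.y_bdry j k a b c d).2]
  z_bdry j k a b c d := by
    simp [(hu.z_bdry j k a b c d).1, (hu.z_bdry j k a b c d).2, (hv.z_bdry j k a b c d).1,
      (hv.z_bdry j k a b c d).2]

theorem IsExt.neumann {u : CellFn} (hu : IsExt G u) (hG : G.Pos) : Neumann G u where
  x_bdry j k _ _ _ _ := by
    have hx := hG.x
    rw [← hu]; simp only [neumannExt]
    constructor <;> congr 1 <;> omega
  y_bdry i k _ _ _ _ := by
    have hx := hG.y
    rw [← hu]; simp only [neumannExt]
    constructor <;> congr 1 <;> omega
  z_bdry i j _ _ _ _ := by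
    have hx := hG.z
    rw [← hu]; simp only [neumannExt]
    constructor <;> congr 1 <;> omega

theorem lap_congr (hG : G.Pos) {u v : CellFn}
    (h : ∀ i j k, IsCell G i j k → div G (grad G u) i j k = div G (grad G v) i j k) :
    lap G u = lap G v := neumannExt_congr hG h

theorem Neumann.lap_ext (hG : G.Pos) {u : CellFn} (hu : Neumann G u) :
    lap G (neumannExt G u) = lap G u := by
  refine lap_congr hG fun i j k h => ?_
  obtain ⟨e0, e1, e2, e3, e4, e5, e6⟩ := hu.stencil hG h
  simp only [div, grad, sub_add_cancel, e0, e1, e2, e3, e4, e5, e6]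

theorem Neumann.gradNormSq_ext (hG : G.Pos) {u : CellFn} (hu : Neumann G u) :
    gradNormSq G (neumannExt G u) = gradNormSq G u := by
  have key : ∀ i j k, IsCell G i j k → _ := fun i j k h => hu.stencil hG h
  simp only [gradNormSq, faceInner, grad, sub_add_cancel]
  congr 1
  congr 1
  all_goals
    congr 1
    refine Finset.sum_congr rfl fun i hi => Finset.sum_congr rfl fun j hj =>
      Finset.sum_congr rfl fun k hk => ?_
    obtain ⟨e0, e1, e2, e3, e4, e5, e6⟩ :=
      key i j k ⟨Finset.mem_Icc.1 hi, Finset.mem_Icc.1 hj, Finset.mem_Icc.1 hk⟩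
    simp only [e0, e1, e2, e3, e4, e5, e6]

theorem normPow_congr (p : ℕ) {u v : CellFn} (h : ∀ i j k, IsCell G i j k → u i j k = v i j k) :
    normPow G p u = normPow G p v := by
  simp only [normPow, cellInner]
  congr 1
  exact cellSum_congr (f := fun i j k => |u i j k| ^ p * 1) (g := fun i j k => |v i j k| ^ p * 1)
    fun i j k hc => by rw [h i j k hc]

theorem modEnergy_ext (hG : G.Pos) (ε : ℝ) {u v : CellFn} (hu : Neumann G u) (hv : Neumann G v) :
    modEnergy G ε (neumannExt G u) (neumannExt G v) = modEnergy G ε u v := by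
  have e : neumannExt G u - neumannExt G v = neumannExt G (u - v) := rfl
  simp only [modEnergy, energy, e, (hu.sub hv).gradNormSq_ext hG, hu.gradNormSq_ext hG]
  rw [normPow_congr 4 fun i j k h => neumannExt_apply (u := u) h,
    normPow_congr 2 fun i j k h => neumannExt_apply (u := u) h,
    normPow_congr 2 fun i j k h => neumannExt_apply (u := u - v) h]

theorem IsStep.ext {ε γ s : ℝ} {a b c μ p : CellFn} (hG : G.Pos)
    (hs : IsStep G ε γ s a b c μ p) (ha : Neumann G a) (hb : Neumann G b) :
    IsStep G ε γ s (neumannExt G a) (neumannExt G b) (neumannExt G c) (neumannExt G μ)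
      (neumannExt G p) where
  neumann_phi := (isExt_neumannExt hG _).neumann hG
  neumann_mu := (isExt_neumannExt hG _).neumann hG
  neumann_p := (isExt_neumannExt hG _).neumann hG
  eq_phi i j k h := by
    have := hs.eq_phi i j k h
    obtain ⟨a0, a1, a2, a3, a4, a5, a6⟩ := ha.stencil hG h
    obtain ⟨b0, b1, b2, b3, b4, b5, b6⟩ := hb.stencil hG h
    obtain ⟨m0, m1, m2, m3, m4, m5, m6⟩ := hs.neumann_mu.stencil hG h
    obtain ⟨p0, p1, p2, p3, p4, p5, p6⟩ := hs.neumann_p.stencil hG h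
    have c0 := neumannExt_apply (u := c) h
    simpa only [div, grad, FaceField.mul, FaceField.comp, avg, extrap, sub_add_cancel, a0, a1, a2,
      a3, a4, a5, a6, b0, b1, b2, b3, b4, b5, b6, m0, m1, m2, m3, m4, m5, m6, p0, p1, p2, p3, p4,
      p5, p6, c0] using this
  eq_mu i j k h := by
    have hl : lap G (fun x y z => 3 / 4 * neumannExt G c x y z + 1 / 4 * neumannExt G a x y z)
        = lap G (fun x y z => 3 / 4 * c x y z + 1 / 4 * a x y z) := by
      change lap G ((3 / 4 : ℝ) • neumannExt G c + (1 / 4 : ℝ) • neumannExt G a)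
        = lap G ((3 / 4 : ℝ) • c + (1 / 4 : ℝ) • a)
      rw [lap_add, lap_smul, lap_smul, ha.lap_ext hG, hs.neumann_phi.lap_ext hG, lap_add, lap_smul,
        lap_smul]
    rw [hl, neumannExt_apply h, hs.eq_mu i j k h]
    simp only [chi, extrap, neumannExt_apply h]
  eq_p i j k h := by
    have := hs.eq_p i j k h
    obtain ⟨a0, a1, a2, a3, a4, a5, a6⟩ := ha.stencil hG h
    obtain ⟨b0, b1, b2, b3, b4, b5, b6⟩ := hb.stencil hG h
    obtain ⟨m0, m1, m2, m3, m4, m5, m6⟩ := hs.neumann_mu.stencil hG h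
    rw [hs.neumann_p.lap_ext hG, this]
    simp only [div, grad, FaceField.mul, avg, extrap, sub_add_cancel, a0, a1, a2,
      a3, a4, a5, a6, b0, b1, b2, b3, b4, b5, b6, m0, m1, m2, m3, m4, m5, m6]

theorem IsSolution.neumann {ε γ s : ℝ} {M : ℕ} {φ : ℕ → CellFn} (h : IsSolution G ε γ s M φ) {m : ℕ}
    (hm : m ≤ M) : Neumann G (φ m) := by
  rcases m with _ | _ | n
  · exact h.neumann_zero
  · exact h.neumann_one
  · obtain ⟨μ, p, hst⟩ := h.step (n + 1) (by omega) (by omega)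
    exact hst.neumann_phi

/-- The estimate for solutions of the scheme, with explicit third differences of the starting
values. -/
theorem third_order_bound {Lx Ly Lz ε : ℝ} (hLx : 0 < Lx) (hLy : 0 < Ly) (hLz : 0 < Lz)
    (hε : 0 < ε) (C₀ : ℝ) : ∃ C₁₁ C₁₀ : ℝ, ∀ (G : Grid) (γ T s : ℝ) (M : ℕ) (φ : ℕ → CellFn),
      G.Discretizes Lx Ly Lz → 0 < γ → 0 < T → 0 < M → s = T / M →
      IsSolution G ε γ s M φ → modEnergy G ε (φ 1) (φ 0) ≤ C₀ →
      ∀ ℓ : ℕ, 1 ≤ ℓ → ℓ + 1 ≤ M →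
        1 / 16 * ε ^ 4 * s * ∑ m ∈ Finset.Icc 1 ℓ, gradNormSq G (lap G (φ m))
          ≤ C₁₁ + C₁₀ * T
            + s * ε ^ 4 * (gradNormSq G (lap G (φ 0)) + gradNormSq G (lap G (φ 1))) := by
  obtain ⟨C₁₁, C₁₀, H⟩ := third_order_bound_of_isExt hLx hLy hLz hε C₀
  refine ⟨C₁₁, C₁₀, ?_⟩
  intro G γ T s M φ hG hγ hT hM hs hsol hF ℓ h1 hℓ
  have hP := hG.pos hLx
  have hN := fun (m : ℕ) (hm : m ≤ M) => hsol.neumann hm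
  have := H G γ T s M (fun m => neumannExt G (φ m)) hG hγ hT hM hs
    (fun m => isExt_neumannExt hP _) (fun m hm hmM => by
      obtain ⟨μ, p, hst⟩ := hsol.step m hm hmM
      exact ⟨_, _, isExt_neumannExt hP μ, isExt_neumannExt hP p,
        hst.ext hP (hN _ (by omega)) (hN _ (by omega))⟩)
    (by rw [modEnergy_ext hP ε (hN 1 (by omega)) (hN 0 (by omega))]; exact hF) ℓ h1 hℓ
  have e : ∀ m ≤ M, gradIp G (lap G (neumannExt G (φ m))) (lap G (neumannExt G (φ m)))
      = gradNormSq G (lap G (φ m)) := fun m hm => by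
    rw [(hN m hm).lap_ext hP, gradNormSq_eq hP (isExt_lap hP _)]
  rw [Finset.sum_congr rfl fun m hm => e m (by have := (Finset.mem_Icc.1 hm).2; omega)] at this
  simp only [e 0 (by omega), e 1 (by omega)] at this
  exact this

/-! ### Finite differences of smooth functions on an interval -/

theorem abs_taylor_one_le {F F' : ℝ → ℝ} {s : Set ℝ} {a b K : ℝ} (hs : Set.uIcc a b ⊆ s)
    (hF : ∀ t ∈ s, HasDerivWithinAt F (F' t) s t)
    (hK : ∀ t ∈ Set.uIcc a b, |F' t - F' a| ≤ K) :
    |F b - F a - F' a * (b - a)| ≤ K * |b - a| := by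
  have h := (convex_uIcc a b).norm_image_sub_le_of_norm_hasDerivWithin_le
    (f := fun t => F t - F' a * (t - a)) (f' := fun t => F' t - F' a) (C := K) (x := a) (y := b)
    (fun t ht => by
      have h1 := (hF t (hs ht)).mono hs
      have h2 := ((hasDerivWithinAt_id t (Set.uIcc a b)).sub_const a).const_mul (F' a)
      refine (h1.sub h2).congr_deriv ?_
      simp)
    (fun t ht => by simpa using hK t ht) Set.left_mem_uIcc Set.right_mem_uIcc
  simp only [Real.norm_eq_abs, sub_self, mul_zero, sub_zero] at h
  rw [show F b - F a - F' a * (b - a) = F b - F' a * (b - a) - F a by ring]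
  exact h

theorem abs_sub_le_of_mem_uIcc {a b t : ℝ} (h : t ∈ Set.uIcc a b) : |t - a| ≤ |b - a| := by
  rcases Set.mem_uIcc.1 h with h | h
  · rw [abs_of_nonneg (by linarith), abs_of_nonneg (by linarith)]; linarith
  · rw [abs_of_nonpos (by linarith), abs_of_nonpos (by linarith)]; linarith

theorem abs_taylor_two_le {f f₁ f₂ : ℝ → ℝ} {L R : ℝ} (hR : 0 ≤ R)
    (h0 : ∀ t ∈ Set.Icc 0 L, HasDerivWithinAt f (f₁ t) (Set.Icc 0 L) t)
    (h1 : ∀ t ∈ Set.Icc 0 L, HasDerivWithinAt f₁ (f₂ t) (Set.Icc 0 L) t)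
    (h2 : ∀ t ∈ Set.Icc 0 L, ∀ t' ∈ Set.Icc 0 L, |f₂ t - f₂ t'| ≤ R * |t - t'|)
    {a b : ℝ} (ha : a ∈ Set.Icc 0 L) (hb : b ∈ Set.Icc 0 L) :
    |f b - f a - f₁ a * (b - a) - f₂ a * (b - a) ^ 2 / 2| ≤ R * |b - a| ^ 3 := by
  have hs : Set.uIcc a b ⊆ Set.Icc 0 L := Set.OrdConnected.uIcc_subset Set.ordConnected_Icc ha hb
  have key : ∀ t ∈ Set.uIcc a b, |f₁ t - f₁ a - f₂ a * (t - a)| ≤ R * |b - a| ^ 2 := by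
    intro t ht
    have hst : Set.uIcc a t ⊆ Set.Icc 0 L :=
      Set.OrdConnected.uIcc_subset Set.ordConnected_Icc ha (hs ht)
    have hle := abs_sub_le_of_mem_uIcc ht
    refine (abs_taylor_one_le (K := R * |b - a|) hst h1 fun x hx => ?_).trans ?_
    · refine (h2 x (hst hx) a ha).trans ?_
      exact mul_le_mul_of_nonneg_left ((abs_sub_le_of_mem_uIcc hx).trans hle) hR
    · rw [sq, ← mul_assoc]; gcongr
  have h := abs_taylor_one_le (F := fun t => f t - f₂ a / 2 * (t - a) ^ 2)
    (F' := fun t => f₁ t - f₂ a * (t - a)) (K := R * |b - a| ^ 2) hs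
    (fun t ht => by
      have e := (((hasDerivWithinAt_id t (Set.Icc 0 L)).sub_const a).pow 2).const_mul (f₂ a / 2)
      refine ((h0 t ht).sub e).congr_deriv ?_
      simp
      ring)
    (fun t ht => by
      have := key t ht
      simp only [sub_self, mul_zero, sub_zero]
      rwa [show f₁ t - f₂ a * (t - a) - f₁ a = f₁ t - f₁ a - f₂ a * (t - a) by ring])
  simp only [sub_self, mul_zero, sub_zero, ne_eq, OfNat.ofNat_ne_zero, not_false_eq_true,
    zero_pow] at h
  rw [show f b - f a - f₁ a * (b - a) - f₂ a * (b - a) ^ 2 / 2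
    = f b - f₂ a / 2 * (b - a) ^ 2 - f a - f₁ a * (b - a) by ring, pow_succ |b - a| 2, ← mul_assoc]
  exact h

/-- The cell centre `(i - 1/2) h`; a ghost index stands for the neighbouring cell. -/
noncomputable def node (N : ℕ) (h : ℝ) (i : ℤ) : ℝ := (((max 1 (min i N) : ℤ) : ℝ) - 1 / 2) * h

theorem node_of_mem {N : ℕ} {h : ℝ} {i : ℤ} (hi : 1 ≤ i ∧ i ≤ N) :
    node N h i = ((i : ℝ) - 1 / 2) * h := by
  rw [node, clamp_eq hi]

theorem node_mem {N : ℕ} {h L : ℝ} (hN : 0 < N) (hh : 0 < h) (hL : N * h = L) (i : ℤ) :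
    node N h i ∈ Set.Icc 0 L := by
  obtain ⟨h1, h2⟩ := clamp_mem hN i
  have h1' : (1 : ℝ) ≤ ((max 1 (min i N) : ℤ) : ℝ) := by exact_mod_cast h1
  have h2' : ((max 1 (min i N) : ℤ) : ℝ) ≤ N := by exact_mod_cast h2
  rw [node, ← hL]
  constructor
  · apply mul_nonneg _ hh.le; linarith
  · gcongr; linarith

theorem node_zero {N : ℕ} (hN : 0 < N) (h : ℝ) : node N h 0 = node N h 1 := by
  have : max 1 (min (0 : ℤ) N) = max 1 (min 1 (N : ℤ)) := by omega
  rw [node, node, this]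

theorem node_succ_top {N : ℕ} (h : ℝ) : node N h (N + 1) = node N h N := by
  have : max 1 (min ((N : ℤ) + 1) N) = max 1 (min (N : ℤ) (N : ℤ)) := by omega
  rw [node, node, this]

theorem abs_node_succ_sub_le {N : ℕ} {h : ℝ} (hh : 0 < h) (i : ℤ) :
    |node N h (i + 1) - node N h i| ≤ h := by
  have h1 : max 1 (min (i + 1) (N : ℤ)) - max 1 (min i (N : ℤ)) ≤ 1 := by omega
  have h2 : 0 ≤ max 1 (min (i + 1) (N : ℤ)) - max 1 (min i (N : ℤ)) := by omega
  have h1' : ((max 1 (min (i + 1) (N : ℤ)) : ℤ) : ℝ) - ((max 1 (min i (N : ℤ)) : ℤ) : ℝ) ≤ 1 := by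
    exact_mod_cast h1
  have h2' : 0 ≤ ((max 1 (min (i + 1) (N : ℤ)) : ℤ) : ℝ) - ((max 1 (min i (N : ℤ)) : ℤ) : ℝ) := by
    exact_mod_cast h2
  have e : node N h (i + 1) - node N h i = (((max 1 (min (i + 1) (N : ℤ)) : ℤ) : ℝ)
      - ((max 1 (min i (N : ℤ)) : ℤ) : ℝ)) * h := by rw [node, node]; ring
  rw [e, abs_of_nonneg (by positivity)]
  nlinarith

/-- The second difference of a function with vanishing derivative at the endpoints approximates the
second derivative up to the boundary: there, Taylor's formula is taken at the endpoint. -/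
theorem abs_second_diff_sub_le {f f₁ f₂ : ℝ → ℝ} {N : ℕ} {h L R : ℝ} (hN : 2 ≤ N) (hh : 0 < h)
    (hL : N * h = L) (hR : 0 ≤ R)
    (h0 : ∀ t ∈ Set.Icc 0 L, HasDerivWithinAt f (f₁ t) (Set.Icc 0 L) t)
    (h1 : ∀ t ∈ Set.Icc 0 L, HasDerivWithinAt f₁ (f₂ t) (Set.Icc 0 L) t)
    (h2 : ∀ t ∈ Set.Icc 0 L, ∀ t' ∈ Set.Icc 0 L, |f₂ t - f₂ t'| ≤ R * |t - t'|)
    (hb0 : f₁ 0 = 0) (hbL : f₁ L = 0) {i : ℤ} (hi : 1 ≤ i ∧ i ≤ N) :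
    |f (node N h (i + 1)) - 2 * f (node N h i) + f (node N h (i - 1)) - h ^ 2 * f₂ (node N h i)|
      ≤ 4 * R * h ^ 3 := by
  have hN0 : 0 < N := by omega
  have hm := node_mem hN0 hh hL
  have hL0 : 0 ≤ L := by rw [← hL]; positivity
  have hRh : 0 ≤ R * h ^ 3 := by positivity
  by_cases hi1 : i = 1
  · subst hi1
    have e2 : node N h 2 = 3 / 2 * h := by
      rw [node_of_mem (by omega)]; push_cast; ring
    have e1 : node N h 1 = 1 / 2 * h := by
      rw [node_of_mem (by omega)]; push_cast; ring
    have m2 := hm 2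
    have m1 := hm 1
    rw [show (1 : ℤ) + 1 = 2 by norm_num, sub_self, node_zero hN0]
    rw [e2] at m2 ⊢
    rw [e1] at m1 ⊢
    have z : (0 : ℝ) ∈ Set.Icc 0 L := ⟨le_rfl, hL0⟩
    have t1 := abs_taylor_two_le hR h0 h1 h2 z m1
    have t2 := abs_taylor_two_le hR h0 h1 h2 z m2
    have t3 := h2 0 z _ m1
    rw [hb0] at t1 t2
    simp only [sub_zero] at t1 t2
    rw [abs_of_nonneg m1.1] at t1
    rw [abs_of_nonneg m2.1] at t2
    rw [zero_sub, abs_neg, abs_of_nonneg m1.1] at t3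
    rw [abs_le] at t1 t2 t3 ⊢
    have t4 := mul_le_mul_of_nonneg_left t3.1 (sq_nonneg h)
    have t5 := mul_le_mul_of_nonneg_left t3.2 (sq_nonneg h)
    constructor <;> linarith [t1.1, t1.2, t2.1, t2.2]
  by_cases hiN : i = N
  · have a1 : |1 / 2 * h| = 1 / 2 * h := abs_of_pos (by positivity)
    have a3 : |3 / 2 * h| = 3 / 2 * h := abs_of_pos (by positivity)
    have hNr : (N : ℝ) = L / h := by rw [← hL]; field_simp
    have e2 : node N h (i - 1) = L - 3 / 2 * h := by
      rw [node_of_mem (by omega), hiN]; push_cast; rw [hNr]; field_simp; ring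
    have e1 : node N h i = L - 1 / 2 * h := by
      rw [node_of_mem hi, hiN]; push_cast; rw [hNr]; field_simp
    have e0 : node N h (i + 1) = node N h i := by rw [hiN]; exact node_succ_top h
    have m2 := hm (i - 1)
    have m1 := hm i
    rw [e0]
    rw [e2] at m2 ⊢
    rw [e1] at m1 ⊢
    have z : L ∈ Set.Icc 0 L := ⟨hL0, le_rfl⟩
    have t1 := abs_taylor_two_le hR h0 h1 h2 z m1
    have t2 := abs_taylor_two_le hR h0 h1 h2 z m2
    have t3 := h2 L z _ m1
    rw [hbL] at t1 t2
    rw [show L - 1 / 2 * h - L = -(1 / 2 * h) by ring, abs_neg, a1] at t1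
    rw [show L - 3 / 2 * h - L = -(3 / 2 * h) by ring, abs_neg, a3] at t2
    rw [show L - (L - 1 / 2 * h) = 1 / 2 * h by ring, a1] at t3
    rw [abs_le] at t1 t2 t3 ⊢
    have t4 := mul_le_mul_of_nonneg_left t3.1 (sq_nonneg h)
    have t5 := mul_le_mul_of_nonneg_left t3.2 (sq_nonneg h)
    constructor <;> linarith [t1.1, t1.2, t2.1, t2.2]
  · have e2 : node N h (i + 1) - node N h i = h := by
      rw [node_of_mem (by omega), node_of_mem hi]; push_cast; ring
    have e1 : node N h (i - 1) - node N h i = -h := by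
      rw [node_of_mem (by omega), node_of_mem hi]; push_cast; ring
    have t1 := abs_taylor_two_le hR h0 h1 h2 (hm i) (hm (i + 1))
    have t2 := abs_taylor_two_le hR h0 h1 h2 (hm i) (hm (i - 1))
    rw [e2, abs_of_pos hh] at t1
    rw [e1, abs_neg, abs_of_pos hh] at t2
    rw [abs_le] at t1 t2 ⊢
    constructor <;> linarith [t1.1, t1.2, t2.1, t2.2]

/-- Third differences are `O(h³)` up to the boundary, although only the second derivative is assumed
to be Lipschitz continuous. -/
theorem abs_third_diff_le {f f₁ f₂ : ℝ → ℝ} {N : ℕ} {h L R : ℝ} (hh : 0 < h)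
    (hL : N * h = L) (hR : 0 ≤ R)
    (h0 : ∀ t ∈ Set.Icc 0 L, HasDerivWithinAt f (f₁ t) (Set.Icc 0 L) t)
    (h1 : ∀ t ∈ Set.Icc 0 L, HasDerivWithinAt f₁ (f₂ t) (Set.Icc 0 L) t)
    (h2 : ∀ t ∈ Set.Icc 0 L, ∀ t' ∈ Set.Icc 0 L, |f₂ t - f₂ t'| ≤ R * |t - t'|)
    (hb0 : f₁ 0 = 0) (hbL : f₁ L = 0) {i : ℤ} (hi : 1 ≤ i ∧ i < N) :
    |f (node N h (i + 1 + 1)) - 2 * f (node N h (i + 1)) + f (node N h (i + 1 - 1))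
      - (f (node N h (i + 1)) - 2 * f (node N h i) + f (node N h (i - 1)))| ≤ 9 * R * h ^ 3 := by
  have a := abs_second_diff_sub_le (by omega) hh hL hR h0 h1 h2 hb0 hbL (i := i) (by omega)
  have b := abs_second_diff_sub_le (by omega) hh hL hR h0 h1 h2 hb0 hbL (i := i + 1) (by omega)
  have hm := node_mem (by omega : 0 < N) hh hL
  have c := (h2 _ (hm (i + 1)) _ (hm i)).trans
    (mul_le_mul_of_nonneg_left (abs_node_succ_sub_le hh i) hR)
  rw [abs_le] at a b c ⊢
  have c1 := mul_le_mul_of_nonneg_left c.1 (sq_nonneg h)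
  have c2 := mul_le_mul_of_nonneg_left c.2 (sq_nonneg h)
  constructor <;> linarith [a.1, a.2, b.1, b.2]

theorem abs_taylor_one_le' {f f₁ f₂ : ℝ → ℝ} {L K : ℝ}
    (h0 : ∀ t ∈ Set.Icc 0 L, HasDerivWithinAt f (f₁ t) (Set.Icc 0 L) t)
    (h1 : ∀ t ∈ Set.Icc 0 L, HasDerivWithinAt f₁ (f₂ t) (Set.Icc 0 L) t)
    (h2 : ∀ t ∈ Set.Icc 0 L, |f₂ t| ≤ K)
    {a b : ℝ} (ha : a ∈ Set.Icc 0 L) (hb : b ∈ Set.Icc 0 L) :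
    |f b - f a - f₁ a * (b - a)| ≤ K * |b - a| ^ 2 := by
  have hs : Set.uIcc a b ⊆ Set.Icc 0 L := Set.OrdConnected.uIcc_subset Set.ordConnected_Icc ha hb
  have hK : 0 ≤ K := (abs_nonneg _).trans (h2 a ha)
  rw [sq, ← mul_assoc]
  refine abs_taylor_one_le hs h0 fun t ht => ?_
  have := (convex_Icc 0 L).norm_image_sub_le_of_norm_hasDerivWithin_le h1
    (fun t ht => h2 t ht) ha (hs ht)
  refine this.trans ?_
  have := abs_sub_le_of_mem_uIcc ht
  rw [Real.norm_eq_abs]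
  gcongr

/-- A bound for the second difference that needs the second derivative only. -/
theorem abs_second_diff_le {f f₁ f₂ : ℝ → ℝ} {N : ℕ} {h L K : ℝ} (hh : 0 < h)
    (hL : N * h = L)
    (h0 : ∀ t ∈ Set.Icc 0 L, HasDerivWithinAt f (f₁ t) (Set.Icc 0 L) t)
    (h1 : ∀ t ∈ Set.Icc 0 L, HasDerivWithinAt f₁ (f₂ t) (Set.Icc 0 L) t)
    (h2 : ∀ t ∈ Set.Icc 0 L, |f₂ t| ≤ K)
    (hb0 : f₁ 0 = 0) (hbL : f₁ L = 0) {i : ℤ} (hi : 1 ≤ i ∧ i ≤ N) :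
    |f (node N h (i + 1)) - 2 * f (node N h i) + f (node N h (i - 1))| ≤ 3 * K * h ^ 2 := by
  have hN0 : 0 < N := by omega
  have hm := node_mem hN0 hh hL
  have hL0 : 0 ≤ L := by rw [← hL]; positivity
  have hK : 0 ≤ K := (abs_nonneg _).trans (h2 _ (hm 1))
  have hKh : 0 ≤ K * h ^ 2 := by positivity
  by_cases hN1 : N = 1
  · have hi1 : i = 1 := by omega
    subst hi1
    have e : node N h (1 + 1) = node N h 1 := by
      subst hN1; exact node_succ_top h
    rw [e, sub_self, node_zero hN0]
    rw [show f (node N h 1) - 2 * f (node N h 1) + f (node N h 1) = 0 by ring, abs_zero]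
    positivity
  by_cases hi1 : i = 1
  · subst hi1
    have e2 : node N h 2 = 3 / 2 * h := by
      rw [node_of_mem (by omega)]; push_cast; ring
    have e1 : node N h 1 = 1 / 2 * h := by
      rw [node_of_mem (by omega)]; push_cast; ring
    have m2 := hm 2
    have m1 := hm 1
    rw [show (1 : ℤ) + 1 = 2 by norm_num, sub_self, node_zero hN0]
    rw [e2] at m2 ⊢
    rw [e1] at m1 ⊢
    have z : (0 : ℝ) ∈ Set.Icc 0 L := ⟨le_rfl, hL0⟩
    have t1 := abs_taylor_one_le' h0 h1 h2 z m1
    have t2 := abs_taylor_one_le' h0 h1 h2 z m2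
    rw [hb0] at t1 t2
    simp only [sub_zero] at t1 t2
    rw [abs_of_nonneg m1.1] at t1
    rw [abs_of_nonneg m2.1] at t2
    rw [abs_le] at t1 t2 ⊢
    constructor <;> linarith [t1.1, t1.2, t2.1, t2.2]
  by_cases hiN : i = N
  · have a1 : |1 / 2 * h| = 1 / 2 * h := abs_of_pos (by positivity)
    have a3 : |3 / 2 * h| = 3 / 2 * h := abs_of_pos (by positivity)
    have hNr : (N : ℝ) = L / h := by rw [← hL]; field_simp
    have e2 : node N h (i - 1) = L - 3 / 2 * h := by
      rw [node_of_mem (by omega), hiN]; push_cast; rw [hNr]; field_simp; ring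
    have e1 : node N h i = L - 1 / 2 * h := by
      rw [node_of_mem hi, hiN]; push_cast; rw [hNr]; field_simp
    have e0 : node N h (i + 1) = node N h i := by rw [hiN]; exact node_succ_top h
    have m2 := hm (i - 1)
    have m1 := hm i
    rw [e0]
    rw [e2] at m2 ⊢
    rw [e1] at m1 ⊢
    have z : L ∈ Set.Icc 0 L := ⟨hL0, le_rfl⟩
    have t1 := abs_taylor_one_le' h0 h1 h2 z m1
    have t2 := abs_taylor_one_le' h0 h1 h2 z m2
    rw [hbL] at t1 t2
    rw [show L - 1 / 2 * h - L = -(1 / 2 * h) by ring, abs_neg, a1] at t1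
    rw [show L - 3 / 2 * h - L = -(3 / 2 * h) by ring, abs_neg, a3] at t2
    rw [abs_le] at t1 t2 ⊢
    constructor <;> linarith [t1.1, t1.2, t2.1, t2.2]
  · have e2 : node N h (i + 1) - node N h i = h := by
      rw [node_of_mem (by omega), node_of_mem hi]; push_cast; ring
    have e1 : node N h (i - 1) - node N h i = -h := by
      rw [node_of_mem (by omega), node_of_mem hi]; push_cast; ring
    have t1 := abs_taylor_one_le' h0 h1 h2 (hm i) (hm (i + 1))
    have t2 := abs_taylor_one_le' h0 h1 h2 (hm i) (hm (i - 1))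
    rw [e2, abs_of_pos hh] at t1
    rw [e1, abs_neg, abs_of_pos hh] at t2
    rw [abs_le] at t1 t2 ⊢
    constructor <;> linarith [t1.1, t1.2, t2.1, t2.2]

/-! ### Regular functions on the cuboid -/

theorem convex_cuboid (Lx Ly Lz : ℝ) : Convex ℝ (cuboid Lx Ly Lz) := by
  intro x hx y hy a b ha hb hab d
  obtain ⟨h1, h2⟩ := hx d
  obtain ⟨h3, h4⟩ := hy d
  simp only [PiLp.add_apply, PiLp.smul_apply, smul_eq_mul]
  constructor
  · positivity
  · have e : ![Lx, Ly, Lz] d = a * ![Lx, Ly, Lz] d + b * ![Lx, Ly, Lz] d := by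
      rw [← add_mul, hab, one_mul]
    rw [e]; gcongr

theorem uniqueDiffOn_cuboid {Lx Ly Lz : ℝ} (hLx : 0 < Lx) (hLy : 0 < Ly) (hLz : 0 < Lz) :
    UniqueDiffOn ℝ (cuboid Lx Ly Lz) := by
  refine uniqueDiffOn_convex (convex_cuboid Lx Ly Lz) ?_
  have ho : IsOpen {x : EuclideanSpace ℝ (Fin 3) | ∀ d, 0 < x d ∧ x d < ![Lx, Ly, Lz] d} := by
    simp only [Set.ofPred_forall]
    refine isOpen_iInter_of_finite fun d => ?_
    have hc : Continuous fun x : EuclideanSpace ℝ (Fin 3) => x d := by fun_prop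
    exact (isOpen_lt continuous_const hc).inter (isOpen_lt hc continuous_const)
  have hsub : {x : EuclideanSpace ℝ (Fin 3) | ∀ d, 0 < x d ∧ x d < ![Lx, Ly, Lz] d}
      ⊆ cuboid Lx Ly Lz := fun x hx d => ⟨(hx d).1.le, (hx d).2.le⟩
  refine ⟨!₂[Lx / 2, Ly / 2, Lz / 2], interior_maximal hsub ho ?_⟩
  intro d
  fin_cases d <;> simp <;> assumption

/-- The point with coordinates `p`. -/
noncomputable abbrev pt (p : Fin 3 → ℝ) : EuclideanSpace ℝ (Fin 3) := WithLp.toLp 2 p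

theorem pt_update_mem {Lx Ly Lz : ℝ} {p : Fin 3 → ℝ} (hp : pt p ∈ cuboid Lx Ly Lz) {d : Fin 3} {t : ℝ}
    (ht : t ∈ Set.Icc 0 (![Lx, Ly, Lz] d)) : pt (Function.update p d t) ∈ cuboid Lx Ly Lz := by
  intro d'
  by_cases h : d' = d
  · subst h; simpa using ht
  · simpa [h] using hp d'

theorem norm_pt_update_sub (p : Fin 3 → ℝ) (d : Fin 3) (t t' : ℝ) :
    ‖pt (Function.update p d t) - pt (Function.update p d t')‖ = |t - t'| := by
  have : pt (Function.update p d t) - pt (Function.update p d t')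
      = EuclideanSpace.single d (t - t') := by
    ext d'
    by_cases h : d' = d
    · subst h; simp
    · simp [h]
  rw [this, PiLp.norm_single, Real.norm_eq_abs]

theorem hasDerivAt_pt_update (p : Fin 3 → ℝ) (d : Fin 3) (t : ℝ) :
    HasDerivAt (fun t => pt (Function.update p d t)) (EuclideanSpace.single d 1) t :=
  ((PiLp.continuousLinearEquiv 2 ℝ (fun _ : Fin 3 => ℝ)).symm.hasFDerivAt
    (x := Function.update p d t)).comp_hasDerivAt t (hasDerivAt_update p d t)

/-- The `n`-th pure derivative in the direction `d`. -/
noncomputable def pureDeriv (Ω : Set (EuclideanSpace ℝ (Fin 3))) (Φ : EuclideanSpace ℝ (Fin 3) → ℝ)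
    (n : ℕ) (d : Fin 3) (x : EuclideanSpace ℝ (Fin 3)) : ℝ :=
  iteratedFDerivWithin ℝ n Φ Ω x (fun _ => EuclideanSpace.single d 1)

variable {Lx Ly Lz R : ℝ} {Φ : EuclideanSpace ℝ (Fin 3) → ℝ}

theorem IsRegular.nonneg (hΦ : IsRegular Lx Ly Lz R Φ) (hLx : 0 < Lx) (hLy : 0 < Ly)
    (hLz : 0 < Lz) : 0 ≤ R := by
  have h0 : (0 : EuclideanSpace ℝ (Fin 3)) ∈ cuboid Lx Ly Lz := by
    intro d; fin_cases d <;> simp <;> linarith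
  exact (norm_nonneg _).trans (hΦ.bound 0 (by norm_num) 0 h0)

theorem IsRegular.differentiableOn (hΦ : IsRegular Lx Ly Lz R Φ)
    (hu : UniqueDiffOn ℝ (cuboid Lx Ly Lz)) {n : ℕ} (hn : n < 3) :
    DifferentiableOn ℝ (iteratedFDerivWithin ℝ n Φ (cuboid Lx Ly Lz)) (cuboid Lx Ly Lz) :=
  hΦ.contDiffOn.differentiableOn_iteratedFDerivWithin (by exact_mod_cast hn) hu

theorem IsRegular.norm_sub_le (hΦ : IsRegular Lx Ly Lz R Φ)
    (hu : UniqueDiffOn ℝ (cuboid Lx Ly Lz)) {n : ℕ} (hn : n < 3) {x y : EuclideanSpace ℝ (Fin 3)}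
    (hx : x ∈ cuboid Lx Ly Lz) (hy : y ∈ cuboid Lx Ly Lz) :
    ‖iteratedFDerivWithin ℝ n Φ (cuboid Lx Ly Lz) x - iteratedFDerivWithin ℝ n Φ (cuboid Lx Ly Lz) y‖
      ≤ R * ‖x - y‖ :=
  (convex_cuboid Lx Ly Lz).norm_image_sub_le_of_norm_fderivWithin_le (hΦ.differentiableOn hu hn)
    (fun z hz => by
      rw [norm_fderivWithin_iteratedFDerivWithin]
      exact hΦ.bound (n + 1) (by omega) z hz) hy hx

theorem IsRegular.abs_pureDeriv_sub_le (hΦ : IsRegular Lx Ly Lz R Φ)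
    (hu : UniqueDiffOn ℝ (cuboid Lx Ly Lz)) {n : ℕ} (hn : n < 3) (d : Fin 3)
    {x y : EuclideanSpace ℝ (Fin 3)} (hx : x ∈ cuboid Lx Ly Lz) (hy : y ∈ cuboid Lx Ly Lz) :
    |pureDeriv (cuboid Lx Ly Lz) Φ n d x - pureDeriv (cuboid Lx Ly Lz) Φ n d y| ≤ R * ‖x - y‖ := by
  have h := ContinuousMultilinearMap.le_opNorm
    (iteratedFDerivWithin ℝ n Φ (cuboid Lx Ly Lz) x - iteratedFDerivWithin ℝ n Φ (cuboid Lx Ly Lz) y)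
    (fun _ => EuclideanSpace.single d 1)
  simp only [PiLp.norm_single, norm_one, Finset.prod_const_one, mul_one] at h
  exact h.trans (hΦ.norm_sub_le hu hn hx hy)

theorem IsRegular.hasDerivWithinAt (hΦ : IsRegular Lx Ly Lz R Φ)
    (hu : UniqueDiffOn ℝ (cuboid Lx Ly Lz)) {n : ℕ} (hn : n < 3) {p : Fin 3 → ℝ}
    (hp : pt p ∈ cuboid Lx Ly Lz) (d : Fin 3) {t : ℝ} (ht : t ∈ Set.Icc 0 (![Lx, Ly, Lz] d)) :
    HasDerivWithinAt (fun t => pureDeriv (cuboid Lx Ly Lz) Φ n d (pt (Function.update p d t)))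
      (pureDeriv (cuboid Lx Ly Lz) Φ (n + 1) d (pt (Function.update p d t)))
      (Set.Icc 0 (![Lx, Ly, Lz] d)) t := by
  have h1 := (hΦ.differentiableOn hu hn _ (pt_update_mem hp ht)).hasFDerivWithinAt
  have h2 := h1.comp_hasDerivWithinAt t (hasDerivAt_pt_update p d t).hasDerivWithinAt
    (fun x hx => pt_update_mem hp hx)
  exact ((ContinuousMultilinearMap.apply ℝ (fun _ : Fin n => EuclideanSpace ℝ (Fin 3)) ℝ
    (fun _ => EuclideanSpace.single d 1)).hasFDerivAt).comp_hasDerivWithinAt t h2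

theorem pureDeriv_zero (Ω : Set (EuclideanSpace ℝ (Fin 3))) (d : Fin 3) :
    pureDeriv Ω Φ 0 d = Φ := by
  funext x; simp [pureDeriv]

theorem IsRegular.pureDeriv_one_eq_zero (hΦ : IsRegular Lx Ly Lz R Φ)
    (hu : UniqueDiffOn ℝ (cuboid Lx Ly Lz)) {x : EuclideanSpace ℝ (Fin 3)}
    (hx : x ∈ cuboid Lx Ly Lz) {d : Fin 3} (hd : x d = 0 ∨ x d = ![Lx, Ly, Lz] d) :
    pureDeriv (cuboid Lx Ly Lz) Φ 1 d x = 0 := by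
  rw [pureDeriv, iteratedFDerivWithin_one_apply (hu x hx)]
  exact hΦ.neumann x hx d hd

/-- Third differences in one direction. -/
theorem IsRegular.abs_pure_diff_le (hΦ : IsRegular Lx Ly Lz R Φ)
    (hu : UniqueDiffOn ℝ (cuboid Lx Ly Lz)) (hR : 0 ≤ R) {p : Fin 3 → ℝ}
    (hp : pt p ∈ cuboid Lx Ly Lz) (d : Fin 3) {N : ℕ} {h : ℝ} (hh : 0 < h)
    (hL : N * h = ![Lx, Ly, Lz] d) {i : ℤ} (hi : 1 ≤ i ∧ i < N) :
    |Φ (pt (Function.update p d (node N h (i + 1 + 1))))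
        - 2 * Φ (pt (Function.update p d (node N h (i + 1))))
        + Φ (pt (Function.update p d (node N h (i + 1 - 1))))
      - (Φ (pt (Function.update p d (node N h (i + 1))))
        - 2 * Φ (pt (Function.update p d (node N h i)))
        + Φ (pt (Function.update p d (node N h (i - 1)))))| ≤ 9 * R * h ^ 3 := by
  have hL0 : 0 ≤ ![Lx, Ly, Lz] d := by rw [← hL]; positivity
  have z0 : (0 : ℝ) ∈ Set.Icc 0 (![Lx, Ly, Lz] d) := ⟨le_rfl, hL0⟩
  have zL : ![Lx, Ly, Lz] d ∈ Set.Icc 0 (![Lx, Ly, Lz] d) := ⟨hL0, le_rfl⟩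
  refine abs_third_diff_le (f := fun t => Φ (pt (Function.update p d t)))
    (f₁ := fun t => pureDeriv (cuboid Lx Ly Lz) Φ 1 d (pt (Function.update p d t)))
    (f₂ := fun t => pureDeriv (cuboid Lx Ly Lz) Φ 2 d (pt (Function.update p d t))) hh hL hR
    (fun t ht => ?_) (fun t ht => hΦ.hasDerivWithinAt hu (by norm_num) hp d ht)
    (fun t ht t' ht' => ?_) ?_ ?_ hi
  · have := hΦ.hasDerivWithinAt hu (n := 0) (by norm_num) hp d ht
    rwa [pureDeriv_zero] at this
  · rw [← norm_pt_update_sub p d t t']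
    exact hΦ.abs_pureDeriv_sub_le hu (by norm_num) d (pt_update_mem hp ht) (pt_update_mem hp ht')
  · exact hΦ.pureDeriv_one_eq_zero hu (pt_update_mem hp z0) (by simp)
  · exact hΦ.pureDeriv_one_eq_zero hu (pt_update_mem hp zL) (by simp)

/-- Second differences in the direction `d` of a first difference in the direction `d'`. -/
theorem IsRegular.abs_mixed_diff_le (hΦ : IsRegular Lx Ly Lz R Φ)
    (hu : UniqueDiffOn ℝ (cuboid Lx Ly Lz)) (hR : 0 ≤ R) {p : Fin 3 → ℝ}
    (hp : pt p ∈ cuboid Lx Ly Lz) {d d' : Fin 3} (hdd : d ≠ d') {N : ℕ} {h : ℝ} (hh : 0 < h)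
    (hL : N * h = ![Lx, Ly, Lz] d) {i : ℤ} (hi : 1 ≤ i ∧ i ≤ N) {s s' : ℝ}
    (hs : s ∈ Set.Icc 0 (![Lx, Ly, Lz] d')) (hs' : s' ∈ Set.Icc 0 (![Lx, Ly, Lz] d'))
    (hss : |s' - s| ≤ h) :
    |Φ (pt (Function.update (Function.update p d' s') d (node N h (i + 1))))
        - 2 * Φ (pt (Function.update (Function.update p d' s') d (node N h i)))
        + Φ (pt (Function.update (Function.update p d' s') d (node N h (i - 1))))
      - (Φ (pt (Function.update (Function.update p d' s) d (node N h (i + 1))))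
        - 2 * Φ (pt (Function.update (Function.update p d' s) d (node N h i)))
        + Φ (pt (Function.update (Function.update p d' s) d (node N h (i - 1)))))|
      ≤ 3 * R * h ^ 3 := by
  have hL0 : 0 ≤ ![Lx, Ly, Lz] d := by rw [← hL]; positivity
  have z0 : (0 : ℝ) ∈ Set.Icc 0 (![Lx, Ly, Lz] d) := ⟨le_rfl, hL0⟩
  have zL : ![Lx, Ly, Lz] d ∈ Set.Icc 0 (![Lx, Ly, Lz] d) := ⟨hL0, le_rfl⟩
  have hp1 := pt_update_mem hp hs
  have hp2 := pt_update_mem hp hs'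
  have key := abs_second_diff_le
    (f := fun t => Φ (pt (Function.update (Function.update p d' s') d t))
      - Φ (pt (Function.update (Function.update p d' s) d t)))
    (f₁ := fun t =>
      pureDeriv (cuboid Lx Ly Lz) Φ 1 d (pt (Function.update (Function.update p d' s') d t))
      - pureDeriv (cuboid Lx Ly Lz) Φ 1 d (pt (Function.update (Function.update p d' s) d t)))
    (f₂ := fun t =>
      pureDeriv (cuboid Lx Ly Lz) Φ 2 d (pt (Function.update (Function.update p d' s') d t))
      - pureDeriv (cuboid Lx Ly Lz) Φ 2 d (pt (Function.update (Function.update p d' s) d t)))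
    (K := R * h) hh hL
    (fun t ht => by
      have e1 := hΦ.hasDerivWithinAt hu (n := 0) (by norm_num) hp1 d ht
      have e2 := hΦ.hasDerivWithinAt hu (n := 0) (by norm_num) hp2 d ht
      rw [pureDeriv_zero] at e1 e2
      exact e2.sub e1)
    (fun t ht => (hΦ.hasDerivWithinAt hu (by norm_num) hp2 d ht).sub
      (hΦ.hasDerivWithinAt hu (by norm_num) hp1 d ht))
    (fun t ht => by
      refine (hΦ.abs_pureDeriv_sub_le hu (by norm_num) d (pt_update_mem hp2 ht)
        (pt_update_mem hp1 ht)).trans ?_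
      rw [Function.update_comm hdd.symm, Function.update_comm hdd.symm, norm_pt_update_sub]
      gcongr)
    (by
      rw [hΦ.pureDeriv_one_eq_zero hu (pt_update_mem hp2 z0) (by simp),
        hΦ.pureDeriv_one_eq_zero hu (pt_update_mem hp1 z0) (by simp), sub_zero])
    (by
      rw [hΦ.pureDeriv_one_eq_zero hu (pt_update_mem hp2 zL) (by simp),
        hΦ.pureDeriv_one_eq_zero hu (pt_update_mem hp1 zL) (by simp), sub_zero]) hi
  rw [show 3 * R * h ^ 3 = 3 * (R * h) * h ^ 2 by ring]
  refine le_of_eq_of_le (congrArg abs ?_) key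
  ring

/-! ### Bounds for the starting values -/

theorem update_fst (x y z t : ℝ) : Function.update ![x, y, z] 0 t = ![t, y, z] := by
  ext d; fin_cases d <;> rfl
theorem update_snd (x y z t : ℝ) : Function.update ![x, y, z] 1 t = ![x, t, z] := by
  ext d; fin_cases d <;> rfl
theorem update_trd (x y z t : ℝ) : Function.update ![x, y, z] 2 t = ![x, y, t] := by
  ext d; fin_cases d <;> rfl

/-- The values of the extended grid projection. -/
theorem IsProjection.ext_apply {φ : CellFn} (h : IsProjection G Φ φ) (hG : G.Pos) (i j k : ℤ) :
    neumannExt G φ i j k = Φ (pt ![node G.Nx G.h i, node G.Ny G.h j, node G.Nz G.h k]) :=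
  h _ _ _ (isCell_clamp hG i j k)

theorem pt_node_mem (hG : G.Discretizes Lx Ly Lz) (hLx : 0 < Lx) (i j k : ℤ) :
    pt ![node G.Nx G.h i, node G.Ny G.h j, node G.Nz G.h k] ∈ cuboid Lx Ly Lz := by
  have hP := hG.pos hLx
  intro d
  fin_cases d
  · exact node_mem hP.x hP.h hG.mul_x i
  · exact node_mem hP.y hP.h hG.mul_y j
  · exact node_mem hP.z hP.h hG.mul_z k

theorem ip_self_le_of_abs_le (hG : G.Discretizes Lx Ly Lz) (hLx : 0 < Lx) {f : CellFn} {K : ℝ}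
    (h : ∀ i j k, IsCell G i j k → |f i j k| ≤ K) : ip G f f ≤ Lx * Ly * Lz * K ^ 2 := by
  have hP := hG.pos hLx
  rw [← hG.volume, ip, mul_assoc (G.h ^ 3), ← cellSum_const]
  refine mul_le_mul_of_nonneg_left (cellSum_mono fun i j k hc => ?_) (pow_nonneg hP.h.le 3)
  have := sq_le_sq' (abs_le.1 (h i j k hc)).1 (abs_le.1 (h i j k hc)).2
  simpa [sq] using this

theorem gradIp_self_le_of_abs_le (hG : G.Discretizes Lx Ly Lz) (hLx : 0 < Lx) {u : CellFn} {K : ℝ}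
    (h : ∀ i j k, IsCell G i j k → |dx G u i j k| ≤ K ∧ |dy G u i j k| ≤ K ∧ |dz G u i j k| ≤ K) :
    gradIp G u u ≤ 3 * (Lx * Ly * Lz * K ^ 2) := by
  have h1 := ip_self_le_of_abs_le hG hLx fun i j k hc => (h i j k hc).1
  have h2 := ip_self_le_of_abs_le hG hLx fun i j k hc => (h i j k hc).2.1
  have h3 := ip_self_le_of_abs_le hG hLx fun i j k hc => (h i j k hc).2.2
  rw [gradIp]; linarith

/-- The grid projection of a regular function has bounded values and difference quotients. -/
theorem IsProjection.h1_le {φ : CellFn} (h : IsProjection G Φ φ) (hΦ : IsRegular Lx Ly Lz R Φ)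
    (hG : G.Discretizes Lx Ly Lz) (hLx : 0 < Lx) (hLy : 0 < Ly) (hLz : 0 < Lz) :
    (∀ i j k, |neumannExt G φ i j k| ≤ R) ∧
    ∀ i j k, |dx G (neumannExt G φ) i j k| ≤ R ∧ |dy G (neumannExt G φ) i j k| ≤ R ∧
      |dz G (neumannExt G φ) i j k| ≤ R := by
  have hP := hG.pos hLx
  have hu := uniqueDiffOn_cuboid hLx hLy hLz
  have hR := hΦ.nonneg hLx hLy hLz
  have hlip : ∀ x ∈ cuboid Lx Ly Lz, ∀ y ∈ cuboid Lx Ly Lz, ‖x - y‖ ≤ G.h →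
      |(Φ x - Φ y) / G.h| ≤ R := by
    intro x hx y hy hxy
    have e := hΦ.abs_pureDeriv_sub_le hu (n := 0) (by norm_num) 0 hx hy
    rw [pureDeriv_zero] at e
    rw [abs_div, abs_of_pos hP.h, div_le_iff₀ hP.h]
    exact e.trans (by gcongr)
  have hm := pt_node_mem hG hLx
  refine ⟨fun i j k => ?_, fun i j k => ⟨?_, ?_, ?_⟩⟩
  · rw [h.ext_apply hP]
    have := hΦ.bound 0 (by norm_num) _ (hm i j k)
    simpa using this
  · simp only [dx, h.ext_apply hP]
    refine hlip _ (hm _ _ _) _ (hm _ _ _) ?_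
    have e := norm_pt_update_sub ![0, node G.Ny G.h j, node G.Nz G.h k] 0 (node G.Nx G.h (i + 1))
      (node G.Nx G.h i)
    rw [update_fst, update_fst] at e
    rw [e]
    exact abs_node_succ_sub_le hP.h i
  · simp only [dy, h.ext_apply hP]
    refine hlip _ (hm _ _ _) _ (hm _ _ _) ?_
    have e := norm_pt_update_sub ![node G.Nx G.h i, 0, node G.Nz G.h k] 1 (node G.Ny G.h (j + 1))
      (node G.Ny G.h j)
    rw [update_snd, update_snd] at e
    rw [e]
    exact abs_node_succ_sub_le hP.h j
  · simp only [dz, h.ext_apply hP]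
    refine hlip _ (hm _ _ _) _ (hm _ _ _) ?_
    have e := norm_pt_update_sub ![node G.Nx G.h i, node G.Ny G.h j, 0] 2 (node G.Nz G.h (k + 1))
      (node G.Nz G.h k)
    rw [update_trd, update_trd] at e
    rw [e]
    exact abs_node_succ_sub_le hP.h k

theorem abs_sum_div_le {a b c h R : ℝ} (hh : 0 < h) (ha : |a| ≤ 9 * R * h ^ 3)
    (hb : |b| ≤ 3 * R * h ^ 3) (hc : |c| ≤ 3 * R * h ^ 3) : |(a + b + c) / h ^ 3| ≤ 15 * R := by
  have : 0 < h ^ 3 := by positivity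
  rw [abs_div, abs_of_pos this, div_le_iff₀ this]
  have := abs_add_three a b c
  linarith

theorem lap_apply {u : CellFn} {i j k : ℤ} (h : IsCell G i j k) :
    lap G u i j k = ((u (i + 1) j k - 2 * u i j k + u (i - 1) j k)
      + (u i (j + 1) k - 2 * u i j k + u i (j - 1) k)
      + (u i j (k + 1) - 2 * u i j k + u i j (k - 1))) / G.h ^ 2 := by
  rw [lap, neumannExt_apply h]
  simp only [div, grad, sub_add_cancel]
  ring

theorem IsProjection.abs_dx_lap_le {φ : CellFn} (h : IsProjection G Φ φ)
    (hΦ : IsRegular Lx Ly Lz R Φ) (hG : G.Discretizes Lx Ly Lz) (hLx : 0 < Lx) (hLy : 0 < Ly)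
    (hLz : 0 < Lz) {i j k : ℤ} (hc : IsCell G i j k) :
    |dx G (lap G (neumannExt G φ)) i j k| ≤ 15 * R := by
  have hP := hG.pos hLx
  have hu := uniqueDiffOn_cuboid hLx hLy hLz
  have hR := hΦ.nonneg hLx hLy hLz
  obtain ⟨⟨i1, i2⟩, hj, hk⟩ := hc
  rcases eq_or_lt_of_le i2 with hi | hi
  · rw [hi, ((isExt_lap hP _).vanishX hP j k).2, abs_zero]; positivity
  have hx := node_mem hP.x hP.h hG.mul_x
  have hp := pt_node_mem hG hLx i j k
  have a := hΦ.abs_pure_diff_le hu hR hp 0 hP.h hG.mul_x ⟨i1, hi⟩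
  have b := hΦ.abs_mixed_diff_le hu hR hp (d := 1) (d' := 0) (by decide) hP.h hG.mul_y hj (hx i)
    (hx (i + 1)) (abs_node_succ_sub_le hP.h i)
  have c := hΦ.abs_mixed_diff_le hu hR hp (d := 2) (d' := 0) (by decide) hP.h hG.mul_z hk (hx i)
    (hx (i + 1)) (abs_node_succ_sub_le hP.h i)
  simp only [update_fst, update_snd, update_trd] at a b c
  refine le_of_eq_of_le (congrArg abs ?_) (abs_sum_div_le hP.h a b c)
  rw [dx, lap_apply ⟨⟨by omega, by omega⟩, hj, hk⟩, lap_apply ⟨⟨i1, i2⟩, hj, hk⟩]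
  simp only [h.ext_apply hP]
  ring

theorem IsProjection.abs_dy_lap_le {φ : CellFn} (h : IsProjection G Φ φ)
    (hΦ : IsRegular Lx Ly Lz R Φ) (hG : G.Discretizes Lx Ly Lz) (hLx : 0 < Lx) (hLy : 0 < Ly)
    (hLz : 0 < Lz) {i j k : ℤ} (hc : IsCell G i j k) :
    |dy G (lap G (neumannExt G φ)) i j k| ≤ 15 * R := by
  have hP := hG.pos hLx
  have hu := uniqueDiffOn_cuboid hLx hLy hLz
  have hR := hΦ.nonneg hLx hLy hLz
  obtain ⟨hi, ⟨j1, j2⟩, hk⟩ := hc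
  rcases eq_or_lt_of_le j2 with hj | hj
  · rw [hj, ((isExt_lap hP _).vanishY hP i k).2, abs_zero]; positivity
  have hx := node_mem hP.y hP.h hG.mul_y
  have hp := pt_node_mem hG hLx i j k
  have a := hΦ.abs_pure_diff_le hu hR hp 1 hP.h hG.mul_y ⟨j1, hj⟩
  have b := hΦ.abs_mixed_diff_le hu hR hp (d := 0) (d' := 1) (by decide) hP.h hG.mul_x hi (hx j)
    (hx (j + 1)) (abs_node_succ_sub_le hP.h j)
  have c := hΦ.abs_mixed_diff_le hu hR hp (d := 2) (d' := 1) (by decide) hP.h hG.mul_z hk (hx j)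
    (hx (j + 1)) (abs_node_succ_sub_le hP.h j)
  simp only [update_fst, update_snd, update_trd] at a b c
  refine le_of_eq_of_le (congrArg abs ?_) (abs_sum_div_le hP.h a b c)
  rw [dy, lap_apply ⟨hi, ⟨by omega, by omega⟩, hk⟩, lap_apply ⟨hi, ⟨j1, j2⟩, hk⟩]
  simp only [h.ext_apply hP]
  ring

theorem IsProjection.abs_dz_lap_le {φ : CellFn} (h : IsProjection G Φ φ)
    (hΦ : IsRegular Lx Ly Lz R Φ) (hG : G.Discretizes Lx Ly Lz) (hLx : 0 < Lx) (hLy : 0 < Ly)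
    (hLz : 0 < Lz) {i j k : ℤ} (hc : IsCell G i j k) :
    |dz G (lap G (neumannExt G φ)) i j k| ≤ 15 * R := by
  have hP := hG.pos hLx
  have hu := uniqueDiffOn_cuboid hLx hLy hLz
  have hR := hΦ.nonneg hLx hLy hLz
  obtain ⟨hi, hj, ⟨k1, k2⟩⟩ := hc
  rcases eq_or_lt_of_le k2 with hk | hk
  · rw [hk, ((isExt_lap hP _).vanishZ hP i j).2, abs_zero]; positivity
  have hx := node_mem hP.z hP.h hG.mul_z
  have hp := pt_node_mem hG hLx i j k
  have a := hΦ.abs_pure_diff_le hu hR hp 2 hP.h hG.mul_z ⟨k1, hk⟩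
  have b := hΦ.abs_mixed_diff_le hu hR hp (d := 0) (d' := 2) (by decide) hP.h hG.mul_x hi (hx k)
    (hx (k + 1)) (abs_node_succ_sub_le hP.h k)
  have c := hΦ.abs_mixed_diff_le hu hR hp (d := 1) (d' := 2) (by decide) hP.h hG.mul_y hj (hx k)
    (hx (k + 1)) (abs_node_succ_sub_le hP.h k)
  simp only [update_fst, update_snd, update_trd] at a b c
  refine le_of_eq_of_le (congrArg abs ?_) (abs_sum_div_le hP.h a b c)
  rw [dz, lap_apply ⟨hi, hj, ⟨by omega, by omega⟩⟩, lap_apply ⟨hi, hj, ⟨k1, k2⟩⟩]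
  simp only [h.ext_apply hP]
  ring

/-- The third differences of the grid projection of a regular function are bounded. -/
theorem IsProjection.gradNormSq_lap_le {φ : CellFn} (h : IsProjection G Φ φ) (hN : Neumann G φ)
    (hΦ : IsRegular Lx Ly Lz R Φ) (hG : G.Discretizes Lx Ly Lz) (hLx : 0 < Lx) (hLy : 0 < Ly)
    (hLz : 0 < Lz) : gradNormSq G (lap G φ) ≤ 3 * (Lx * Ly * Lz * (15 * R) ^ 2) := by
  have hP := hG.pos hLx
  rw [← hN.lap_ext hP, gradNormSq_eq hP (isExt_lap hP _)]
  exact gradIp_self_le_of_abs_le hG hLx fun i j k hc =>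
    ⟨h.abs_dx_lap_le hΦ hG hLx hLy hLz hc, h.abs_dy_lap_le hΦ hG hLx hLy hLz hc,
      h.abs_dz_lap_le hΦ hG hLx hLy hLz hc⟩

/-- The modified energy of the grid projections of two regular functions is bounded. -/
theorem modEnergy_le_of_isProjection {Φ₀ Φ₁ : EuclideanSpace ℝ (Fin 3) → ℝ} {φ₀ φ₁ : CellFn} (ε : ℝ)
    (h₀ : IsProjection G Φ₀ φ₀) (h₁ : IsProjection G Φ₁ φ₁) (hN₀ : Neumann G φ₀)
    (hN₁ : Neumann G φ₁) (hΦ₀ : IsRegular Lx Ly Lz R Φ₀) (hΦ₁ : IsRegular Lx Ly Lz R Φ₁)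
    (hG : G.Discretizes Lx Ly Lz) (hLx : 0 < Lx) (hLy : 0 < Ly) (hLz : 0 < Lz) :
    modEnergy G ε φ₁ φ₀ ≤ Lx * Ly * Lz * (R ^ 4 / 4 + R ^ 2 + 3 * ε ^ 2 * R ^ 2) := by
  have hP := hG.pos hLx
  have x0 := isExt_neumannExt hP φ₀
  have x1 := isExt_neumannExt hP φ₁
  rw [← modEnergy_ext hP ε hN₁ hN₀, modEnergy_eq hP ε x1 x0]
  obtain ⟨a0, b0⟩ := h₀.h1_le hΦ₀ hG hLx hLy hLz
  obtain ⟨a1, b1⟩ := h₁.h1_le hΦ₁ hG hLx hLy hLz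
  have hR := hΦ₀.nonneg hLx hLy hLz
  have i0 := ip_self_le_of_abs_le hG hLx fun i j k _ => a0 i j k
  have i1 := ip_self_le_of_abs_le hG hLx fun i j k _ => a1 i j k
  have g0 := gradIp_self_le_of_abs_le hG hLx fun i j k _ => b0 i j k
  have g1 := gradIp_self_le_of_abs_le hG hLx fun i j k _ => b1 i j k
  set u := neumannExt G φ₁
  set v := neumannExt G φ₀
  have i2 : ip G (u * u) (u * u) ≤ Lx * Ly * Lz * (R * R) ^ 2 :=
    ip_self_le_of_abs_le hG hLx fun i j k _ => by
      simp only [Pi.mul_apply, abs_mul]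
      exact mul_le_mul (a1 i j k) (a1 i j k) (abs_nonneg _) hR
  have n1 := ip_self_nonneg hP u
  have n2 := ip_self_nonneg hP (u + v)
  have n3 := gradIp_self_nonneg hP (u + v)
  have i3 : ip G (u - v) (u - v) ≤ 2 * (ip G u u + ip G v v) := by
    simp only [ip_add_left, ip_add_right, ip_sub_left, ip_sub_right, ip_comm v u] at n2 ⊢
    linarith
  have g3 : gradIp G (u - v) (u - v) ≤ 2 * (gradIp G u u + gradIp G v v) := by
    simp only [gradIp_add_left, gradIp_add_right, gradIp_sub_left, gradIp_sub_right,
      gradIp_comm v u] at n3 ⊢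
    linarith
  have k1 := mul_le_mul_of_nonneg_left g1 (sq_nonneg ε)
  have k2 := mul_le_mul_of_nonneg_left (g3.trans (by linarith : _ ≤
    2 * (3 * (Lx * Ly * Lz * R ^ 2) + 3 * (Lx * Ly * Lz * R ^ 2)))) (sq_nonneg ε)
  linarith

end CHHS

theorem mainTheorem2 (Lx Ly Lz ε : ℝ) (hLx : 0 < Lx) (hLy : 0 < Ly) (hLz : 0 < Lz) (hε : 0 < ε) :
    (∀ C₀ : ℝ, ∃ C₁₀ : ℝ, ∀ K : ℝ, ∃ C₁₁ : ℝ,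
      ∀ (G : CHHS.Grid) (γ T s : ℝ) (M : ℕ) (φ : ℕ → CHHS.CellFn),
        G.Discretizes Lx Ly Lz → 0 < γ → 0 < T → 0 < M → s = T / M →
        CHHS.IsSolution G ε γ s M φ →
        CHHS.modEnergy G ε (φ 1) (φ 0) ≤ C₀ →
        s * CHHS.gradNormSq G (CHHS.lap G (φ 0)) ≤ K →
        s * CHHS.gradNormSq G (CHHS.lap G (φ 1)) ≤ K →
        ∀ ℓ : ℕ, 1 ≤ ℓ → ℓ + 1 ≤ M →
          (1 / 16) * ε ^ 4 * s *
              ∑ m ∈ Finset.Icc 1 ℓ, CHHS.gradNormSq G (CHHS.lap G (φ m))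
            ≤ C₁₁ + C₁₀ * T) ∧
    (∀ R : ℝ, ∃ C₁₀ C₁₁ : ℝ,
      ∀ (Φ₀ Φ₁ : EuclideanSpace ℝ (Fin 3) → ℝ)
        (G : CHHS.Grid) (γ T s : ℝ) (M : ℕ) (φ : ℕ → CHHS.CellFn),
        CHHS.IsRegular Lx Ly Lz R Φ₀ → CHHS.IsRegular Lx Ly Lz R Φ₁ →
        G.Discretizes Lx Ly Lz → 0 < γ → 0 < T → 0 < M → s = T / M →
        CHHS.IsSolution G ε γ s M φ →
        CHHS.IsProjection G Φ₀ (φ 0) → CHHS.IsProjection G Φ₁ (φ 1) →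
        ∀ ℓ : ℕ, 1 ≤ ℓ → ℓ + 1 ≤ M →
          (1 / 16) * ε ^ 4 * s *
              ∑ m ∈ Finset.Icc 1 ℓ, CHHS.gradNormSq G (CHHS.lap G (φ m))
            ≤ C₁₁ + C₁₀ * T) := by
  constructor
  · intro C₀
    obtain ⟨C₁₁, C₁₀, H⟩ := CHHS.third_order_bound hLx hLy hLz hε C₀
    refine ⟨C₁₀, fun K => ⟨C₁₁ + 2 * ε ^ 4 * K, ?_⟩⟩
    intro G γ T s M φ hG hγ hT hM hs hsol hF hK₀ hK₁ ℓ h1 hℓ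
    have h := H G γ T s M φ hG hγ hT hM hs hsol hF ℓ h1 hℓ
    have e₀ := mul_le_mul_of_nonneg_left hK₀ (show 0 ≤ ε ^ 4 by positivity)
    have e₁ := mul_le_mul_of_nonneg_left hK₁ (show 0 ≤ ε ^ 4 by positivity)
    linarith
  · intro R
    obtain ⟨C₁₁, C₁₀, H⟩ := CHHS.third_order_bound hLx hLy hLz hε
      (Lx * Ly * Lz * (R ^ 4 / 4 + R ^ 2 + 3 * ε ^ 2 * R ^ 2))
    refine ⟨C₁₀ + 2 * ε ^ 4 * (3 * (Lx * Ly * Lz * (15 * R) ^ 2)), C₁₁, ?_⟩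
    intro Φ₀ Φ₁ G γ T s M φ hΦ₀ hΦ₁ hG hγ hT hM hs hsol hp₀ hp₁ ℓ h1 hℓ
    have h := H G γ T s M φ hG hγ hT hM hs hsol
      (CHHS.modEnergy_le_of_isProjection ε hp₀ hp₁ hsol.neumann_zero hsol.neumann_one hΦ₀ hΦ₁ hG
        hLx hLy hLz) ℓ h1 hℓ
    have y₀ := hp₀.gradNormSq_lap_le hsol.neumann_zero hΦ₀ hG hLx hLy hLz
    have y₁ := hp₁.gradNormSq_lap_le hsol.neumann_one hΦ₁ hG hLx hLy hLz
    have hM1 : (1 : ℝ) ≤ M := by exact_mod_cast hM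
    have hsT : s ≤ T := by rw [hs]; exact div_le_self hT.le hM1
    have hs0 : 0 ≤ s := by rw [hs]; positivity
    have e : s * ε ^ 4 * (CHHS.gradNormSq G (CHHS.lap G (φ 0))
          + CHHS.gradNormSq G (CHHS.lap G (φ 1)))
        ≤ T * ε ^ 4 * (3 * (Lx * Ly * Lz * (15 * R) ^ 2) + 3 * (Lx * Ly * Lz * (15 * R) ^ 2)) := by
      calc _ ≤ s * ε ^ 4
            * (3 * (Lx * Ly * Lz * (15 * R) ^ 2) + 3 * (Lx * Ly * Lz * (15 * R) ^ 2)) := by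
            gcongr
        _ ≤ _ := by gcongr
    linarith
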